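/- Consider, for $2\pi$-periodic functions $f,v,p$ of the angle $\theta$ on $S^1$ (with $f\in C^2$ and $v,p\in C^1$), the system $$(p-2f)'=0,\qquad -f''+vf'-f^2-|v|^2-2p=0,\qquad v'=0, \tag{12}$$ which describes the $(-1)$-homogeneous steady Navier–Stokes flows in $\mathbb R^2\setminus\{0\}$ with radial component $f$, tangential component $v$ and pressure $p$, together with the zero flux condition $\int_0^{2\pi} f\,d\theta=0$. There are smooth functions $\tilde f_k:\mathbb R\to\mathbb R$, $k=3,4,5,\dots$, such that a triple $(f,v,p)$ satisfies (12) and the zero flux condition if and only if * either $f=0$, $v$ is constant and $p=-|v|^2/2$, * or there are an integer $k\ge 3$ and $\theta_0\in\mathbb R$ with $$f(\theta)=\tilde f_k(\theta-\theta_0),\qquad v=0,\qquad p=2f+c_k,\qquad c_k=-\frac1{4\pi}\int_0^{2\pi}|\tilde f_k|^2\,d\theta .$$ (So every $\theta_0$ is allowed.) Moreover: * for each $k\ge3$, $\tilde f_k$ is not identically zero and is periodic with minimal period $2\pi/k$ (hence, by the classification, $\tilde f_k$ is unique up to rotation); * $\tilde f_k$ is expressed through the Jacobi elliptic function $\mathrm{cn}$: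 there are real numbers $e_1>e_2>e_3$, depending on $k$, with $e_1+e_2+e_3=-6$ and $$\tilde f_k(\theta)=e_2+(e_1-e_2)\,\mathrm{cn}^2\!\left(\sqrt{\tfrac{e_1-e_3}{6}}\;\theta\ \Big|\ m\right),\qquad m=\frac{e_1-e_2}{e_1-e_3},$$ where $\mathrm{cn}(x\,|\,m)=\cos\varphi$ with $x=\int_0^\varphi (1-m\sin^2 t)^{-1/2}\,dt$; * the amplitude of oscillation of $\tilde f_k$ is of order $k^2$: there are constants $0<a\le A$ with $a k^2\le \max\tilde f_k-\min\tilde f_k\le A k^2$ for all $k\ge3$. -/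

import Mathlib

open scoped ContDiff

/-- The reduced system on the circle for a `(-1)`-homogeneous steady flow in the plane.  Functions on
the circle are `2π`-periodic functions of the angle `θ`: `f` is the radial component of the velocity,
`v` its tangential component, `p` the pressure.  Solutions are understood in the classical sense. -/
structure IsReducedSolution (f v p : ℝ → ℝ) : Prop where
  periodic_f : Function.Periodic f (2 * Real.pi)
  periodic_v : Function.Periodic v (2 * Real.pi)
  periodic_p : Function.Periodic p (2 * Real.pi)
  contDiff_f : ContDiff ℝ 2 f
  contDiff_v : ContDiff ℝ 1 v
  contDiff_p : ContDiff ℝ 1 p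
  tangential : ∀ θ, deriv (fun t => p t - 2 * f t) θ = 0
  radial : ∀ θ, -deriv (deriv f) θ + v θ * deriv f θ - f θ ^ 2 - |v θ| ^ 2 - 2 * p θ = 0
  divergence : ∀ θ, deriv v θ = 0

/-- The zero flux condition `∫_{S¹} f = 0`. -/
def ZeroFlux (f : ℝ → ℝ) : Prop :=
  ∫ θ in (0 : ℝ)..(2 * Real.pi), f θ = 0

/-- `T` is the minimal period of `f`: the least positive period. -/
def HasMinimalPeriod (f : ℝ → ℝ) (T : ℝ) : Prop :=
  IsLeast {S : ℝ | 0 < S ∧ Function.Periodic f S} T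

/-- The amplitude of oscillation `max f - min f` (used for continuous periodic functions, whose range
is compact). -/
noncomputable def oscillationAmplitude (f : ℝ → ℝ) : ℝ :=
  sSup (Set.range f) - sInf (Set.range f)

/-- The incomplete elliptic integral of the first kind with parameter `m`, as a function of `φ`. -/
noncomputable def ellipticIntegralF (m φ : ℝ) : ℝ :=
  ∫ t in (0 : ℝ)..φ, 1 / Real.sqrt (1 - m * Real.sin t ^ 2)

/-- The Jacobi amplitude `am(x | m)`: the inverse of `φ ↦ F(φ | m)`, which for `m < 1` is an increasing
bijection of the real line. -/
noncomputable def jacobiAm (m : ℝ) : ℝ → ℝ :=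
  Function.invFun (ellipticIntegralF m)

/-- The Jacobi elliptic function `cn(x | m) = cos (am(x | m))`, for real argument and `m < 1`. -/
noncomputable def jacobiCn (m x : ℝ) : ℝ :=
  Real.cos (jacobiAm m x)

/-- `f` is expressed through the elliptic function `cn`: with real roots `e₁ > e₂ > e₃` of sum `-6`,
`f(θ) = e₂ + (e₁ - e₂) cn²(√((e₁ - e₃)/6) θ | m)`, where `m = (e₁ - e₂)/(e₁ - e₃) ∈ (0, 1)`. -/
def IsCnoidal (f : ℝ → ℝ) : Prop :=
  ∃ e₁ e₂ e₃ : ℝ, e₃ < e₂ ∧ e₂ < e₁ ∧ e₁ + e₂ + e₃ = -6 ∧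
    ∀ θ, f θ = e₂ + (e₁ - e₂) *
      jacobiCn ((e₁ - e₂) / (e₁ - e₃)) (Real.sqrt ((e₁ - e₃) / 6) * θ) ^ 2

/-! Write Δ for `ellipticDelta`, and K, E for its inverse and itself integrated over [0, π]. The
system makes v a constant w, p = 2f + c and f'' = w f' - f² - 4f - d with d = w² + 2c. The energy of
this equation has derivative w f'², so if w ≠ 0 periodicity forces f to be constant, hence zero by
the flux condition. If w = 0, energy conservation reads 3f'² = 2(e₁ - f)(f - e₂)(f - e₃) with roots
of sum -6. A nonconstant periodic f oscillates between e₂ and e₁, and ODE uniqueness at a maximum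
makes it a rotated cnoidal wave (`exists_eq_cnoidalWave`).

It remains to find the waves of period 2π and mean zero. With L = e₁ - e₃ and m = (e₁ - e₂)/L, the
conditions are √(L/6)·2π = kK, e₃K + LE = 0 and 3e₃ + (2 - m)L = -6. Eliminating e₃ and L leaves
k²G(m) = 4π² with G = K(3E - (2 - m)K). This G decreases strictly on [0, 1) from G(0) = π² to
nonpositive values, so there is exactly one m for each k ≥ 3 and none for k ≤ 2. The amplitude is mL
= 3mk²K²/(2π²), of order k² because m stays away from 0 and 1. -/

/-! ### The elliptic integral F and the Jacobi amplitude -/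

/-- The radicand `√(1 - m sin² t)`, i.e. `dn` as a function of the amplitude. -/
noncomputable def ellipticDelta (m t : ℝ) : ℝ := Real.sqrt (1 - m * Real.sin t ^ 2)

theorem one_sub_mul_sin_sq_pos {m : ℝ} (h1 : m < 1) (t : ℝ) : 0 < 1 - m * Real.sin t ^ 2 := by
  rcases le_or_gt m 0 with h | h
  · nlinarith [sq_nonneg (Real.sin t)]
  · nlinarith [Real.sin_sq_le_one t]

theorem ellipticDelta_pos {m : ℝ} (h1 : m < 1) (t : ℝ) : 0 < ellipticDelta m t :=
  Real.sqrt_pos.2 (one_sub_mul_sin_sq_pos h1 t)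

theorem ellipticDelta_sq {m : ℝ} (h1 : m < 1) (t : ℝ) :
    ellipticDelta m t ^ 2 = 1 - m * Real.sin t ^ 2 :=
  Real.sq_sqrt (one_sub_mul_sin_sq_pos h1 t).le

theorem ellipticDelta_le_one {m : ℝ} (h0 : 0 ≤ m) (t : ℝ) : ellipticDelta m t ≤ 1 :=
  Real.sqrt_le_one.2 (by nlinarith [sq_nonneg (Real.sin t)])

theorem contDiff_ellipticDelta {m : ℝ} (h1 : m < 1) : ContDiff ℝ ∞ (ellipticDelta m) := by
  unfold ellipticDelta
  exact ContDiff.sqrt (by fun_prop) fun t => (one_sub_mul_sin_sq_pos h1 t).ne'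

theorem continuous_ellipticDelta (m : ℝ) : Continuous (ellipticDelta m) := by
  unfold ellipticDelta; fun_prop

theorem hasDerivAt_ellipticDelta {m : ℝ} (h1 : m < 1) (t : ℝ) :
    HasDerivAt (ellipticDelta m) (-(m * Real.sin t * Real.cos t) / ellipticDelta m t) t := by
  have h := ((((Real.hasDerivAt_sin t).pow 2).const_mul m).const_sub 1).sqrt
    (one_sub_mul_sin_sq_pos h1 t).ne'
  refine h.congr_deriv ?_
  have := ellipticDelta_pos h1 t
  change _ / (2 * ellipticDelta m t) = _
  field_simp
  norm_num
  ring

theorem ellipticDelta_add_pi (m t : ℝ) : ellipticDelta m (t + Real.pi) = ellipticDelta m t := by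
  simp [ellipticDelta, Real.sin_add_pi]

theorem ellipticIntegralF_eq (m φ : ℝ) :
    ellipticIntegralF m φ = ∫ t in (0 : ℝ)..φ, (ellipticDelta m t)⁻¹ := by
  simp [ellipticIntegralF, ellipticDelta]

theorem continuous_inv_ellipticDelta {m : ℝ} (h1 : m < 1) :
    Continuous fun t => (ellipticDelta m t)⁻¹ :=
  (continuous_ellipticDelta m).inv₀ fun t => (ellipticDelta_pos h1 t).ne'

theorem hasDerivAt_ellipticIntegralF {m : ℝ} (h1 : m < 1) (φ : ℝ) :
    HasDerivAt (ellipticIntegralF m) (ellipticDelta m φ)⁻¹ φ := by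
  rw [show ellipticIntegralF m = fun φ => ∫ t in (0 : ℝ)..φ, (ellipticDelta m t)⁻¹ from
    funext (ellipticIntegralF_eq m)]
  exact (continuous_inv_ellipticDelta h1).integral_hasStrictDerivAt 0 φ |>.hasDerivAt

theorem ellipticIntegralF_zero (m : ℝ) : ellipticIntegralF m 0 = 0 := by
  simp [ellipticIntegralF]

theorem strictMono_ellipticIntegralF {m : ℝ} (h1 : m < 1) : StrictMono (ellipticIntegralF m) :=
  strictMono_of_deriv_pos fun φ => by
    rw [(hasDerivAt_ellipticIntegralF h1 φ).deriv]
    exact inv_pos.2 (ellipticDelta_pos h1 φ)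

/-- The integrand 1/Δ is at least 1. This yields both the surjectivity of F and the bound K ≥ π. -/
theorem monotone_ellipticIntegralF_sub {m : ℝ} (h0 : 0 ≤ m) (h1 : m < 1) :
    Monotone fun φ => ellipticIntegralF m φ - φ := by
  have h : ∀ φ, HasDerivAt (fun φ => ellipticIntegralF m φ - φ) ((ellipticDelta m φ)⁻¹ - 1) φ :=
    fun φ => (hasDerivAt_ellipticIntegralF h1 φ).sub (hasDerivAt_id φ)
  refine monotone_of_deriv_nonneg (fun φ => (h φ).differentiableAt) fun φ => ?_
  rw [(h φ).deriv, sub_nonneg]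
  exact (one_le_inv₀ (ellipticDelta_pos h1 φ)).2 (ellipticDelta_le_one h0 φ)

theorem surjective_ellipticIntegralF {m : ℝ} (h0 : 0 ≤ m) (h1 : m < 1) :
    Function.Surjective (ellipticIntegralF m) := by
  have hc : Continuous (ellipticIntegralF m) :=
    continuous_iff_continuousAt.2 fun φ => (hasDerivAt_ellipticIntegralF h1 φ).continuousAt
  have hm := monotone_ellipticIntegralF_sub h0 h1
  refine hc.surjective ?_ ?_
  · refine Filter.tendsto_atTop_mono' _ ?_ Filter.tendsto_id
    filter_upwards [Filter.eventually_ge_atTop 0] with φ hφ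
    simpa [ellipticIntegralF_zero] using hm hφ
  · refine Filter.tendsto_atBot_mono' _ ?_ Filter.tendsto_id
    filter_upwards [Filter.eventually_le_atBot 0] with φ hφ
    simpa [ellipticIntegralF_zero] using hm hφ

theorem ellipticIntegralF_jacobiAm {m : ℝ} (h0 : 0 ≤ m) (h1 : m < 1) (x : ℝ) :
    ellipticIntegralF m (jacobiAm m x) = x :=
  Function.rightInverse_invFun (surjective_ellipticIntegralF h0 h1) x

theorem jacobiAm_ellipticIntegralF {m : ℝ} (h1 : m < 1) (φ : ℝ) :
    jacobiAm m (ellipticIntegralF m φ) = φ :=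
  Function.leftInverse_invFun (strictMono_ellipticIntegralF h1).injective φ

theorem jacobiAm_zero {m : ℝ} (h1 : m < 1) : jacobiAm m 0 = 0 := by
  simpa [ellipticIntegralF_zero] using jacobiAm_ellipticIntegralF h1 0

theorem continuous_jacobiAm {m : ℝ} (h0 : 0 ≤ m) (h1 : m < 1) : Continuous (jacobiAm m) := by
  let e := (strictMono_ellipticIntegralF h1).orderIsoOfSurjective _
    (surjective_ellipticIntegralF h0 h1)
  have : jacobiAm m = e.symm := by
    ext x
    apply e.injective
    rw [e.apply_symm_apply]
    exact ellipticIntegralF_jacobiAm h0 h1 x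
  rw [this]
  exact e.symm.continuous

theorem hasDerivAt_jacobiAm {m : ℝ} (h0 : 0 ≤ m) (h1 : m < 1) (x : ℝ) :
    HasDerivAt (jacobiAm m) (ellipticDelta m (jacobiAm m x)) x := by
  have h := HasDerivAt.of_local_left_inverse (continuous_jacobiAm h0 h1).continuousAt
    (hasDerivAt_ellipticIntegralF h1 (jacobiAm m x))
    (inv_pos.2 (ellipticDelta_pos h1 _)).ne'
    (Filter.Eventually.of_forall (ellipticIntegralF_jacobiAm h0 h1))
  simpa using h

/-- Bootstrap on am' = Δ(am): each order of smoothness of am gives the next. -/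
theorem contDiff_jacobiAm {m : ℝ} (h0 : 0 ≤ m) (h1 : m < 1) : ContDiff ℝ ∞ (jacobiAm m) := by
  refine contDiff_infty.2 fun n => ?_
  induction n with
  | zero => exact contDiff_zero.2 (continuous_jacobiAm h0 h1)
  | succ n ih =>
    have hd : deriv (jacobiAm m) = fun x => ellipticDelta m (jacobiAm m x) :=
      funext fun x => (hasDerivAt_jacobiAm h0 h1 x).deriv
    push_cast
    refine contDiff_succ_iff_deriv.2
      ⟨fun x => (hasDerivAt_jacobiAm h0 h1 x).differentiableAt, by simp, ?_⟩
    rw [hd]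
    exact ((contDiff_ellipticDelta h1).of_le (by exact_mod_cast le_top)).comp ih

/-! ### Complete integrals and quasi-periodicity -/

theorem integral_zero_int_mul_pi {h : ℝ → ℝ} (hp : Function.Periodic h Real.pi)
    (hc : Continuous h)
    (j : ℤ) : ∫ t in (0 : ℝ)..(j * Real.pi), h t = j * ∫ t in (0 : ℝ)..Real.pi, h t := by
  simpa using hp.intervalIntegral_add_zsmul_eq j 0 fun a b => hc.intervalIntegrable a b

/-- `ellipticK m` is `2 K(m)`, twice the complete elliptic integral of the first kind. -/
noncomputable def ellipticK (m : ℝ) : ℝ := ∫ t in (0 : ℝ)..Real.pi, (ellipticDelta m t)⁻¹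

/-- `ellipticE m` is `2 E(m)`, twice the complete elliptic integral of the second kind. -/
noncomputable def ellipticE (m : ℝ) : ℝ := ∫ t in (0 : ℝ)..Real.pi, ellipticDelta m t

theorem ellipticIntegralF_int_mul_pi {m : ℝ} (h1 : m < 1) (j : ℤ) :
    ellipticIntegralF m (j * Real.pi) = j * ellipticK m := by
  rw [ellipticIntegralF_eq, ellipticK]
  exact integral_zero_int_mul_pi (fun t => by simp [ellipticDelta_add_pi])
    (continuous_inv_ellipticDelta h1) j

theorem ellipticIntegralF_add_int_mul_pi {m : ℝ} (h1 : m < 1) (φ : ℝ) (j : ℤ) :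
    ellipticIntegralF m (φ + j * Real.pi) = ellipticIntegralF m φ + j * ellipticK m := by
  have hp : Function.Periodic (fun t => (ellipticDelta m t)⁻¹) Real.pi :=
    fun t => by simp [ellipticDelta_add_pi]
  have hi := fun a b => (continuous_inv_ellipticDelta h1).intervalIntegrable
    (μ := MeasureTheory.volume) a b
  rw [← ellipticIntegralF_int_mul_pi h1, ellipticIntegralF_eq, ellipticIntegralF_eq,
    ellipticIntegralF_eq, ← intervalIntegral.integral_add_adjacent_intervals (hi 0 φ) (hi φ _)]
  congr 1
  have h := hp.int_mul j
  simpa using h.intervalIntegral_add_eq φ 0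

theorem jacobiAm_add_int_mul {m : ℝ} (h0 : 0 ≤ m) (h1 : m < 1) (x : ℝ) (j : ℤ) :
    jacobiAm m (x + j * ellipticK m) = jacobiAm m x + j * Real.pi := by
  apply (strictMono_ellipticIntegralF h1).injective
  rw [ellipticIntegralF_jacobiAm h0 h1, ellipticIntegralF_add_int_mul_pi h1,
    ellipticIntegralF_jacobiAm h0 h1]

theorem pi_le_ellipticK {m : ℝ} (h0 : 0 ≤ m) (h1 : m < 1) : Real.pi ≤ ellipticK m := by
  have := monotone_ellipticIntegralF_sub h0 h1 Real.pi_pos.le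
  simp only [ellipticIntegralF_eq] at this
  simpa [ellipticK] using this

theorem ellipticK_le {m : ℝ} (h0 : 0 ≤ m) (h1 : m < 1) :
    ellipticK m ≤ Real.pi / Real.sqrt (1 - m) := by
  have : ellipticK m ≤ ∫ t in (0 : ℝ)..Real.pi, (Real.sqrt (1 - m))⁻¹ := by
    refine intervalIntegral.integral_mono_on Real.pi_pos.le
      ((continuous_inv_ellipticDelta h1).intervalIntegrable _ _) (by simp) fun t _ => ?_
    refine inv_anti₀ (Real.sqrt_pos.2 (by linarith)) (Real.sqrt_le_sqrt ?_)
    nlinarith [Real.sin_sq_le_one t]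
  simpa [div_eq_mul_inv] using this

theorem ellipticE_le_pi {m : ℝ} (h0 : 0 ≤ m) : ellipticE m ≤ Real.pi := by
  have : ellipticE m ≤ ∫ t in (0 : ℝ)..Real.pi, (1 : ℝ) :=
    intervalIntegral.integral_mono_on Real.pi_pos.le
      ((continuous_ellipticDelta m).intervalIntegrable _ _) (by simp)
      fun t _ => ellipticDelta_le_one h0 t
  simpa using this

theorem continuous_inv_ellipticDelta_cube {m : ℝ} (h1 : m < 1) :
    Continuous fun t => (ellipticDelta m t ^ 3)⁻¹ :=
  ((continuous_ellipticDelta m).pow 3).inv₀ fun t => (pow_pos (ellipticDelta_pos h1 t) 3).ne'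

/-- This primitive vanishes at 0 and π, so integrating its derivative expresses ∫ Δ⁻³ through E. -/
theorem hasDerivAt_sin_mul_cos_div_ellipticDelta {m : ℝ} (h1 : m < 1) (t : ℝ) :
    HasDerivAt (fun t => m * (Real.sin t * Real.cos t / ellipticDelta m t))
      (ellipticDelta m t - (1 - m) * (ellipticDelta m t ^ 3)⁻¹) t := by
  have hp := ellipticDelta_pos h1 t
  have h := ((((Real.hasDerivAt_sin t).mul (Real.hasDerivAt_cos t)).div
    (hasDerivAt_ellipticDelta h1 t) hp.ne').const_mul m)
  refine h.congr_deriv ?_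
  have hs := ellipticDelta_sq h1 t
  have hc := Real.sin_sq_add_cos_sq t
  simp only [Pi.mul_apply]
  set D := ellipticDelta m t
  set s := Real.sin t
  set c := Real.cos t
  field_simp
  have hc' : c ^ 2 = 1 - s ^ 2 := by linarith
  have e : D ^ 4 = (1 - m * s ^ 2) ^ 2 := by rw [← hs]; ring
  have : m * (D ^ 2 * (c ^ 2 - s ^ 2) + m * s ^ 2 * c ^ 2) = D ^ 4 - (1 - m) := by
    rw [e, hs, hc']; ring
  linarith

/-- The integral of `Δ⁻³` over a half-turn is `2 E(m) / (1 - m)`. -/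
theorem ellipticE_eq_integral_inv_cube {m : ℝ} (h1 : m < 1) :
    ellipticE m = (1 - m) * ∫ t in (0 : ℝ)..Real.pi, (ellipticDelta m t ^ 3)⁻¹ := by
  have h3 := (continuous_inv_ellipticDelta_cube h1)
  have hI := intervalIntegral.integral_eq_sub_of_hasDerivAt (a := 0) (b := Real.pi)
    (fun t _ => hasDerivAt_sin_mul_cos_div_ellipticDelta h1 t)
    (((continuous_ellipticDelta m).sub (h3.const_mul _)).intervalIntegrable _ _)
  rw [intervalIntegral.integral_sub ((continuous_ellipticDelta m).intervalIntegrable _ _)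
    ((h3.const_mul _).intervalIntegrable _ _), intervalIntegral.integral_const_mul] at hI
  simp only [Real.sin_pi, Real.sin_zero, zero_mul, zero_div, mul_zero, sub_zero] at hI
  unfold ellipticE
  linarith

/-! ### Dependence of K and E on the parameter -/

theorem hasDerivAt_inv_ellipticDelta_param {m : ℝ} (h1 : m < 1) (t : ℝ) :
    HasDerivAt (fun m => (ellipticDelta m t)⁻¹)
      (Real.sin t ^ 2 / 2 * (ellipticDelta m t ^ 3)⁻¹) m ∧
    HasDerivAt (fun m => ellipticDelta m t)
      (-(Real.sin t ^ 2 / 2) * (ellipticDelta m t)⁻¹) m := by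
  have hp := ellipticDelta_pos h1 t
  have h : HasDerivAt (fun m => ellipticDelta m t)
      (-(Real.sin t ^ 2 / 2) * (ellipticDelta m t)⁻¹) m := by
    have h := (((hasDerivAt_id m).mul_const (Real.sin t ^ 2)).const_sub 1).sqrt
      (one_sub_mul_sin_sq_pos h1 t).ne'
    refine h.congr_deriv ?_
    change _ / (2 * ellipticDelta m t) = _
    field_simp
  refine ⟨(h.inv hp.ne').congr_deriv ?_, h⟩
  field_simp

theorem sqrt_le_ellipticDelta {m m' : ℝ} (h0 : 0 ≤ m') (h : m ≤ m') (t : ℝ) :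
    Real.sqrt (1 - m') ≤ ellipticDelta m t := by
  refine Real.sqrt_le_sqrt ?_
  nlinarith [Real.sin_sq_le_one t, sq_nonneg (Real.sin t)]

theorem hasDerivAt_ellipticK_integral {m : ℝ} (h0 : 0 ≤ m) (h1 : m < 1) :
    HasDerivAt ellipticK
      (∫ t in (0 : ℝ)..Real.pi, Real.sin t ^ 2 / 2 * (ellipticDelta m t ^ 3)⁻¹) m := by
  -- The midpoint of m and 1 keeps nearby parameters away from 1, so Δ ≥ √(1 - b) gives a constant
  -- dominating function.
  set b := (m + 1) / 2 with hb
  have hb1 : b < 1 := by linarith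
  have hpos : 0 < Real.sqrt (1 - b) := Real.sqrt_pos.2 (by linarith)
  refine (intervalIntegral.hasDerivAt_integral_of_dominated_loc_of_deriv_le
    (F := fun m t => (ellipticDelta m t)⁻¹)
    (F' := fun m t => Real.sin t ^ 2 / 2 * (ellipticDelta m t ^ 3)⁻¹)
    (bound := fun _ => (Real.sqrt (1 - b) ^ 3)⁻¹)
    (s := Set.Iio b) (Iio_mem_nhds (by linarith)) ?_ ?_ ?_ ?_ ?_ ?_).2
  · filter_upwards [Iio_mem_nhds h1] with x hx
    exact (continuous_inv_ellipticDelta hx).aestronglyMeasurable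
  · exact (continuous_inv_ellipticDelta h1).intervalIntegrable _ _
  · exact (((Real.continuous_sin.pow 2).div_const 2).mul
      (continuous_inv_ellipticDelta_cube h1)).aestronglyMeasurable
  · refine Filter.Eventually.of_forall fun t _ x hx => ?_
    have hx1 : x < 1 := lt_trans hx hb1
    have hp := pow_pos (ellipticDelta_pos hx1 t) 3
    rw [Real.norm_of_nonneg (by positivity)]
    have : (ellipticDelta x t ^ 3)⁻¹ ≤ (Real.sqrt (1 - b) ^ 3)⁻¹ :=
      inv_anti₀ (by positivity)
        (pow_le_pow_left₀ hpos.le (sqrt_le_ellipticDelta (by linarith) (le_of_lt hx) t) 3)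
    have h2 := inv_pos.2 hp
    nlinarith [Real.sin_sq_le_one t]
  · simp
  · exact Filter.Eventually.of_forall fun t _ x hx =>
      (hasDerivAt_inv_ellipticDelta_param (lt_trans hx hb1) t).1

theorem hasDerivAt_ellipticE_integral {m : ℝ} (h0 : 0 ≤ m) (h1 : m < 1) :
    HasDerivAt ellipticE
      (∫ t in (0 : ℝ)..Real.pi, -(Real.sin t ^ 2 / 2) * (ellipticDelta m t)⁻¹) m := by
  set b := (m + 1) / 2 with hb
  have hb1 : b < 1 := by linarith
  have hpos : 0 < Real.sqrt (1 - b) := Real.sqrt_pos.2 (by linarith)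
  refine (intervalIntegral.hasDerivAt_integral_of_dominated_loc_of_deriv_le
    (F := fun m t => ellipticDelta m t)
    (F' := fun m t => -(Real.sin t ^ 2 / 2) * (ellipticDelta m t)⁻¹)
    (bound := fun _ => (Real.sqrt (1 - b))⁻¹)
    (s := Set.Iio b) (Iio_mem_nhds (by linarith)) ?_ ?_ ?_ ?_ ?_ ?_).2
  · exact Filter.Eventually.of_forall fun x => (continuous_ellipticDelta x).aestronglyMeasurable
  · exact (continuous_ellipticDelta m).intervalIntegrable _ _
  · exact (((Real.continuous_sin.pow 2).div_const 2).neg.mul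
      (continuous_inv_ellipticDelta h1)).aestronglyMeasurable
  · refine Filter.Eventually.of_forall fun t _ x hx => ?_
    have hx1 : x < 1 := lt_trans hx hb1
    have hp := ellipticDelta_pos hx1 t
    rw [neg_mul, norm_neg, Real.norm_of_nonneg (by positivity)]
    have : (ellipticDelta x t)⁻¹ ≤ (Real.sqrt (1 - b))⁻¹ :=
      inv_anti₀ hpos (sqrt_le_ellipticDelta (by linarith) (le_of_lt hx) t)
    have h2 := inv_pos.2 hp
    nlinarith [Real.sin_sq_le_one t]
  · simp
  · exact Filter.Eventually.of_forall fun t _ x hx =>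
      (hasDerivAt_inv_ellipticDelta_param (lt_trans hx hb1) t).2

/-- Since m sin² = 1 - Δ², the differentiated integrand is a combination of Δ⁻³ and Δ⁻¹, whose
integrals are E/(1 - m) and K. -/
theorem hasDerivAt_ellipticK {m : ℝ} (h0 : 0 < m) (h1 : m < 1) :
    HasDerivAt ellipticK ((ellipticE m - (1 - m) * ellipticK m) / (2 * m * (1 - m))) m := by
  refine (hasDerivAt_ellipticK_integral h0.le h1).congr_deriv ?_
  have hm : 0 < 1 - m := by linarith
  have : ∀ t, Real.sin t ^ 2 / 2 * (ellipticDelta m t ^ 3)⁻¹ =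
      (2 * m)⁻¹ * ((ellipticDelta m t ^ 3)⁻¹ - (ellipticDelta m t)⁻¹) := fun t => by
    have := ellipticDelta_pos h1 t
    have hs := ellipticDelta_sq h1 t
    field_simp
    linarith
  simp_rw [this]
  rw [intervalIntegral.integral_const_mul, intervalIntegral.integral_sub
    ((continuous_inv_ellipticDelta_cube h1).intervalIntegrable _ _)
    ((continuous_inv_ellipticDelta h1).intervalIntegrable _ _), ellipticE_eq_integral_inv_cube h1,
    ← ellipticK]
  field_simp

theorem hasDerivAt_ellipticE {m : ℝ} (h0 : 0 < m) (h1 : m < 1) :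
    HasDerivAt ellipticE ((ellipticE m - ellipticK m) / (2 * m)) m := by
  refine (hasDerivAt_ellipticE_integral h0.le h1).congr_deriv ?_
  have : ∀ t, -(Real.sin t ^ 2 / 2) * (ellipticDelta m t)⁻¹ =
      (2 * m)⁻¹ * (ellipticDelta m t - (ellipticDelta m t)⁻¹) := fun t => by
    have := ellipticDelta_pos h1 t
    have hs := ellipticDelta_sq h1 t
    field_simp
    linarith
  simp_rw [this]
  rw [intervalIntegral.integral_const_mul, intervalIntegral.integral_sub
    ((continuous_ellipticDelta m).intervalIntegrable _ _)
    ((continuous_inv_ellipticDelta h1).intervalIntegrable _ _), ← ellipticK, ← ellipticE]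
  field_simp

theorem one_sub_mul_ellipticK_le_ellipticE {m : ℝ} (h0 : 0 ≤ m) (h1 : m < 1) :
    (1 - m) * ellipticK m ≤ ellipticE m := by
  rw [ellipticE, ellipticK, ← intervalIntegral.integral_const_mul]
  refine intervalIntegral.integral_mono_on Real.pi_pos.le
    (((continuous_inv_ellipticDelta h1).const_mul _).intervalIntegrable _ _)
    ((continuous_ellipticDelta m).intervalIntegrable _ _) fun t _ => ?_
  have hs := ellipticDelta_sq h1 t
  rw [← div_eq_mul_inv, div_le_iff₀ (ellipticDelta_pos h1 t), ← sq, hs]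
  nlinarith [Real.sin_sq_le_one t]

/-- The integrand (2 - m)Δ⁻¹ - Δ - (1 - m)Δ⁻³ factors as (1 - Δ²)(Δ² - (1 - m))/Δ³ ≥ 0, and its
integral is (2 - m)K - 2E. -/
theorem ellipticE_le {m : ℝ} (h0 : 0 ≤ m) (h1 : m < 1) :
    ellipticE m ≤ (1 - m / 2) * ellipticK m := by
  have hE := ellipticE_eq_integral_inv_cube h1
  set N := ∫ t in (0 : ℝ)..Real.pi, (ellipticDelta m t ^ 3)⁻¹ with hN
  have h3 := continuous_inv_ellipticDelta_cube h1
  have hD := continuous_ellipticDelta m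
  have hi := continuous_inv_ellipticDelta h1
  have : 0 ≤ ∫ t in (0 : ℝ)..Real.pi, ((2 - m) * (ellipticDelta m t)⁻¹ - ellipticDelta m t
      - (1 - m) * (ellipticDelta m t ^ 3)⁻¹) := by
    refine intervalIntegral.integral_nonneg Real.pi_pos.le fun t _ => ?_
    have hp := ellipticDelta_pos h1 t
    have hs := ellipticDelta_sq h1 t
    have : (2 - m) * (ellipticDelta m t)⁻¹ - ellipticDelta m t
      - (1 - m) * (ellipticDelta m t ^ 3)⁻¹ =
      (1 - ellipticDelta m t ^ 2) * (ellipticDelta m t ^ 2 - (1 - m)) / ellipticDelta m t ^ 3 := by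
      field_simp
      ring
    rw [this]
    refine div_nonneg (mul_nonneg ?_ ?_) (by positivity)
    · rw [hs]; nlinarith [sq_nonneg (Real.sin t)]
    · rw [hs]; nlinarith [Real.sin_sq_le_one t]
  rw [intervalIntegral.integral_sub, intervalIntegral.integral_sub,
    intervalIntegral.integral_const_mul, intervalIntegral.integral_const_mul, ← hN,
    ← ellipticK, ← ellipticE] at this
  · linarith
  all_goals exact Continuous.intervalIntegrable (by fun_prop) _ _

/-! ### The function G: monotonicity and range -/

/-- `k² · periodFluxFunction m = 4π²` characterises the parameter of the zero-flux cnoidal wave of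
period `2π / k`. -/
noncomputable def periodFluxFunction (m : ℝ) : ℝ :=
  ellipticK m * (3 * ellipticE m - (2 - m) * ellipticK m)

theorem continuousOn_periodFluxFunction : ContinuousOn periodFluxFunction (Set.Ico 0 1) := by
  have hK : ContinuousOn ellipticK (Set.Ico 0 1) := fun m hm =>
    (hasDerivAt_ellipticK_integral hm.1 hm.2).continuousAt.continuousWithinAt
  have hE : ContinuousOn ellipticE (Set.Ico 0 1) := fun m hm =>
    (hasDerivAt_ellipticE_integral hm.1 hm.2).continuousAt.continuousWithinAt
  unfold periodFluxFunction
  fun_prop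

theorem periodFluxFunction_zero : periodFluxFunction 0 = Real.pi ^ 2 := by
  simp [periodFluxFunction, ellipticK, ellipticE, ellipticDelta]
  ring

theorem strictAntiOn_periodFluxFunction : StrictAntiOn periodFluxFunction (Set.Ico 0 1) := by
  refine strictAntiOn_of_deriv_neg (convex_Ico 0 1) continuousOn_periodFluxFunction fun m hm => ?_
  rw [interior_Ico] at hm
  obtain ⟨h0, h1⟩ := hm
  have hK := hasDerivAt_ellipticK h0 h1
  have hE := hasDerivAt_ellipticE h0 h1
  have h := hK.mul ((hE.const_mul 3).sub (((hasDerivAt_id m).const_sub 2).mul hK))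
  have hle := one_sub_mul_ellipticK_le_ellipticE h0.le h1
  have hge := ellipticE_le h0.le h1
  have hKpos : 0 < ellipticK m := Real.pi_pos.trans_le (pi_le_ellipticK h0.le h1)
  have hm1 : 0 < 1 - m := by linarith
  have : HasDerivAt periodFluxFunction
      ((3 * ellipticE m ^ 2 - 2 * (2 - m) * ellipticK m * ellipticE m +
        (1 - m) * ellipticK m ^ 2) / (2 * m * (1 - m))) m := by
    refine h.congr_deriv ?_
    simp only [id, Pi.mul_apply, Pi.sub_apply]
    field_simp
    ring
  rw [this.deriv]
  refine div_neg_of_neg_of_pos ?_ (by positivity)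
  set K := ellipticK m
  set E := ellipticE m
  have hK2 := mul_pos hKpos hKpos
  -- The numerator is a convex quadratic in E. At the ends of the allowed range, E = (1 - m)K and E
  -- = (1 - m/2)K, it equals -m(1 - m)K² and -m²K²/4, so it is negative in between.
  nlinarith [mul_nonneg (sub_nonneg.2 hle) (sub_nonneg.2 hge), mul_pos h0 hK2,
    mul_pos (mul_pos h0 hm1) hK2, mul_pos (mul_pos h0 h0) hK2,
    mul_nonneg hKpos.le (sub_nonneg.2 hle),
    mul_nonneg hKpos.le (sub_nonneg.2 hge),
    mul_nonneg (mul_nonneg h0.le hKpos.le) (sub_nonneg.2 hle),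
    mul_nonneg (mul_nonneg h0.le hKpos.le) (sub_nonneg.2 hge)]

/-- With m = 1 - ε² and t = π/2 + s, Δ² = sin² s + ε² cos² s ≤ (s + ε)²; integrating 1/(s + ε) gives
the logarithm. Thus K diverges as m tends to 1. -/
theorem ellipticK_ge_log {ε : ℝ} (h0 : 0 < ε) :
    Real.log ((ε + Real.pi / 2) / ε) ≤ ellipticK (1 - ε ^ 2) := by
  have hlt : 1 - ε ^ 2 < 1 := by nlinarith
  have hi := fun a b => (continuous_inv_ellipticDelta hlt).intervalIntegrable
    (μ := MeasureTheory.volume) a b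
  have hpi := Real.pi_pos
  have hsplit : ∫ t in (Real.pi / 2)..Real.pi, (ellipticDelta (1 - ε ^ 2) t)⁻¹ ≤
      ellipticK (1 - ε ^ 2) := by
    rw [ellipticK, ← intervalIntegral.integral_add_adjacent_intervals (hi 0 (Real.pi / 2))
      (hi (Real.pi / 2) Real.pi)]
    refine le_add_of_nonneg_left (intervalIntegral.integral_nonneg (by positivity) fun t _ => ?_)
    exact (inv_pos.2 (ellipticDelta_pos hlt t)).le
  have hshift : ∫ t in (Real.pi / 2)..Real.pi, (ellipticDelta (1 - ε ^ 2) t)⁻¹ =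
      ∫ t in (0 : ℝ)..(Real.pi / 2), (ellipticDelta (1 - ε ^ 2) (t + Real.pi / 2))⁻¹ := by
    rw [intervalIntegral.integral_comp_add_right
      (fun t => (ellipticDelta (1 - ε ^ 2) t)⁻¹) (Real.pi / 2)]
    congr 1 <;> ring
  have hlog : Real.log ((ε + Real.pi / 2) / ε) = ∫ t in (0 : ℝ)..(Real.pi / 2), (t + ε)⁻¹ := by
    rw [intervalIntegral.integral_comp_add_right (fun t => t⁻¹) ε, integral_inv_of_pos
      (by linarith) (by linarith)]
    congr 1
    ring
  rw [hlog]
  refine le_trans ?_ (hshift ▸ hsplit)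
  refine intervalIntegral.integral_mono_on (by positivity) ?_ ?_ fun t ht => ?_
  · refine ContinuousOn.intervalIntegrable (ContinuousOn.inv₀ (by fun_prop) fun t ht => ?_)
    rw [Set.uIcc_of_le (by positivity)] at ht
    linarith [ht.1]
  · exact ((continuous_inv_ellipticDelta hlt).comp (continuous_id.add_const _)).intervalIntegrable
      _ _
  · refine inv_anti₀ (ellipticDelta_pos hlt _) (Real.sqrt_le_iff.2 ⟨by linarith [ht.1], ?_⟩)
    rw [Real.sin_add_pi_div_two]
    have h2 := Real.sin_le ht.1
    have h3 := Real.sin_nonneg_of_nonneg_of_le_pi ht.1 (by linarith [ht.2])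
    nlinarith [Real.sin_sq_add_cos_sq t, ht.1, sq_nonneg (Real.cos t), Real.sin_sq_le_one t]

theorem exists_periodFluxFunction_nonpos :
    ∃ m : ℝ, 0 < m ∧ m < 1 ∧ periodFluxFunction m ≤ 0 := by
  -- Chosen so that the logarithmic bound gives K ≥ 3π; then 3E ≤ 3π ≤ K ≤ (2 - m)K.
  set ε := Real.exp (-(3 * Real.pi)) with hε
  have hpos : 0 < ε := Real.exp_pos _
  have hlt : ε < 1 := by rw [hε, Real.exp_lt_one_iff]; linarith [Real.pi_pos]
  have h0 : 0 < 1 - ε ^ 2 := by nlinarith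
  have h1 : 1 - ε ^ 2 < 1 := by nlinarith
  refine ⟨1 - ε ^ 2, h0, h1, ?_⟩
  have hK : 3 * Real.pi ≤ ellipticK (1 - ε ^ 2) := by
    refine le_trans ?_ (ellipticK_ge_log hpos)
    rw [Real.le_log_iff_exp_le (by positivity), le_div_iff₀ hpos, hε, ← Real.exp_add]
    simp only [add_neg_cancel, Real.exp_zero]
    nlinarith [Real.pi_gt_three, Real.exp_pos (-(3 * Real.pi))]
  have hE := ellipticE_le_pi h0.le
  have := Real.pi_pos
  refine mul_nonpos_of_nonneg_of_nonpos (by linarith) ?_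
  nlinarith

/-- Intermediate values: k ≥ 3 puts 4π²/k² below G(0) = π². That M is independent of k is what later
bounds K uniformly. -/
theorem exists_cnoidal_parameter :
    ∃ M : ℝ, M < 1 ∧ ∀ k : ℕ, 3 ≤ k →
      ∃ m : ℝ, 0 < m ∧ m < M ∧ (k : ℝ) ^ 2 * periodFluxFunction m = 4 * Real.pi ^ 2 := by
  obtain ⟨M, hM0, hM1, hM⟩ := exists_periodFluxFunction_nonpos
  refine ⟨M, hM1, fun k hk => ?_⟩
  have hk' : (3 : ℝ) ≤ k := by exact_mod_cast hk
  have hpi := Real.pi_pos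
  have hmem : 4 * Real.pi ^ 2 / (k : ℝ) ^ 2 ∈
      Set.Ioo (periodFluxFunction M) (periodFluxFunction 0) := by
    refine ⟨hM.trans_lt (by positivity), ?_⟩
    rw [periodFluxFunction_zero, div_lt_iff₀ (by positivity)]
    have := pow_pos hpi 2
    nlinarith [mul_le_mul hk' hk' (by norm_num) (by positivity)]
  obtain ⟨m, hm, he⟩ := intermediate_value_Ioo' hM0.le
    (continuousOn_periodFluxFunction.mono fun x hx => ⟨hx.1, hx.2.trans_lt hM1⟩) hmem
  refine ⟨m, hm.1, hm.2, ?_⟩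
  rw [he]
  field_simp

/-! ### The cnoidal wave: equation, range, periods, mean -/

/-- The cnoidal wave oscillating between `e₂` and `e₁`. -/
noncomputable def cnoidalWave (e₁ e₂ e₃ θ : ℝ) : ℝ :=
  e₂ + (e₁ - e₂) * jacobiCn ((e₁ - e₂) / (e₁ - e₃)) (Real.sqrt ((e₁ - e₃) / 6) * θ) ^ 2

section cnoidalWave

variable {e₁ e₂ e₃ : ℝ}

theorem cnoidal_param_pos (h32 : e₃ < e₂) (h21 : e₂ < e₁) : 0 < (e₁ - e₂) / (e₁ - e₃) :=
  div_pos (by linarith) (by linarith)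

theorem cnoidal_param_lt_one (h32 : e₃ < e₂) (h21 : e₂ < e₁) : (e₁ - e₂) / (e₁ - e₃) < 1 :=
  (div_lt_one (by linarith)).2 (by linarith)

theorem contDiff_cnoidalWave (h32 : e₃ < e₂) (h21 : e₂ < e₁) :
    ContDiff ℝ ∞ (cnoidalWave e₁ e₂ e₃) := by
  have h := contDiff_jacobiAm (cnoidal_param_pos h32 h21).le (cnoidal_param_lt_one h32 h21)
  unfold cnoidalWave jacobiCn
  exact contDiff_const.add (contDiff_const.mul
    ((Real.contDiff_cos.comp (h.comp (contDiff_const.mul contDiff_id))).pow 2))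

/-- The derivative of `cnoidalWave`. -/
noncomputable def cnoidalSlope (e₁ e₂ e₃ θ : ℝ) : ℝ :=
  -(2 * (e₁ - e₂) * Real.sqrt ((e₁ - e₃) / 6)) *
    (Real.sin (jacobiAm ((e₁ - e₂) / (e₁ - e₃)) (Real.sqrt ((e₁ - e₃) / 6) * θ)) *
      Real.cos (jacobiAm ((e₁ - e₂) / (e₁ - e₃)) (Real.sqrt ((e₁ - e₃) / 6) * θ)) *
      ellipticDelta ((e₁ - e₂) / (e₁ - e₃))
        (jacobiAm ((e₁ - e₂) / (e₁ - e₃)) (Real.sqrt ((e₁ - e₃) / 6) * θ)))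

theorem hasDerivAt_jacobiAm_const_mul {m : ℝ} (h0 : 0 ≤ m) (h1 : m < 1) (w θ : ℝ) :
    HasDerivAt (fun θ => jacobiAm m (w * θ)) (ellipticDelta m (jacobiAm m (w * θ)) * w) θ := by
  refine ((hasDerivAt_jacobiAm h0 h1 (w * θ)).comp θ
    ((hasDerivAt_id θ).const_mul w)).congr_deriv ?_
  simp

theorem hasDerivAt_cnoidalWave (h32 : e₃ < e₂) (h21 : e₂ < e₁) (θ : ℝ) :
    HasDerivAt (cnoidalWave e₁ e₂ e₃) (cnoidalSlope e₁ e₂ e₃ θ) θ := by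
  have h0 := (cnoidal_param_pos h32 h21).le
  have h1 := cnoidal_param_lt_one h32 h21
  have h := (((hasDerivAt_jacobiAm_const_mul h0 h1
    (Real.sqrt ((e₁ - e₃) / 6)) θ).cos.pow 2).const_mul (e₁ - e₂)).const_add e₂
  refine h.congr_deriv ?_
  unfold cnoidalSlope
  norm_num
  ring

/-- The linear coefficient would be 2(e₁ + e₂ + e₃)/3 for general roots; the sum -6 makes it -4. -/
theorem hasDerivAt_cnoidalSlope (h32 : e₃ < e₂) (h21 : e₂ < e₁) (hs : e₁ + e₂ + e₃ = -6) (θ : ℝ) :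
    HasDerivAt (cnoidalSlope e₁ e₂ e₃) (-cnoidalWave e₁ e₂ e₃ θ ^ 2 - 4 * cnoidalWave e₁ e₂ e₃ θ
      - (e₁ * e₂ + e₂ * e₃ + e₃ * e₁) / 3) θ := by
  have h0 := (cnoidal_param_pos h32 h21).le
  have h1 := cnoidal_param_lt_one h32 h21
  have hL : 0 < e₁ - e₃ := by linarith
  have hw : Real.sqrt ((e₁ - e₃) / 6) ^ 2 = (e₁ - e₃) / 6 := Real.sq_sqrt (by linarith)
  have hm : (e₁ - e₂) / (e₁ - e₃) * (e₁ - e₃) = e₁ - e₂ := div_mul_cancel₀ _ hL.ne'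
  have ha := hasDerivAt_jacobiAm_const_mul h0 h1 (Real.sqrt ((e₁ - e₃) / 6)) θ
  unfold cnoidalSlope cnoidalWave jacobiCn
  set m := (e₁ - e₂) / (e₁ - e₃)
  set w := Real.sqrt ((e₁ - e₃) / 6)
  have h := ((ha.sin.mul ha.cos).mul
    ((hasDerivAt_ellipticDelta h1 (jacobiAm m (w * θ))).comp θ ha)).const_mul
    (-(2 * (e₁ - e₂) * w))
  refine h.congr_deriv ?_
  have hp := ellipticDelta_pos h1 (jacobiAm m (w * θ))
  have hd := ellipticDelta_sq h1 (jacobiAm m (w * θ))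
  have hc := Real.sin_sq (jacobiAm m (w * θ))
  simp only [Pi.mul_apply, Function.comp_apply]
  set D := ellipticDelta m (jacobiAm m (w * θ))
  set s := Real.sin (jacobiAm m (w * θ))
  set c := Real.cos (jacobiAm m (w * θ))
  have e : -(2 * (e₁ - e₂) * w) * ((c * (D * w) * c + s * (-s * (D * w))) * D +
      s * c * (-(m * s * c) / D * (D * w))) =
      -(2 * (e₁ - e₂)) * w ^ 2 * ((c ^ 2 - s ^ 2) * D ^ 2 - m * s ^ 2 * c ^ 2) := by
    field_simp
    ring
  rw [e, hd, hw, hc]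
  have e3 : -(2 * (e₁ - e₂)) * ((e₁ - e₃) / 6) *
      ((c ^ 2 - (1 - c ^ 2)) * (1 - m * (1 - c ^ 2)) - m * (1 - c ^ 2) * c ^ 2) =
      -((e₁ - e₂) / 3) * ((c ^ 2 - (1 - c ^ 2)) * ((e₁ - e₃) - m * (e₁ - e₃) * (1 - c ^ 2))
        - m * (e₁ - e₃) * (1 - c ^ 2) * c ^ 2) := by ring
  rw [e3, hm]
  have h3 : e₃ = -6 - e₁ - e₂ := by linarith
  rw [h3]
  ring

theorem cnoidalWave_zero (h32 : e₃ < e₂) (h21 : e₂ < e₁) : cnoidalWave e₁ e₂ e₃ 0 = e₁ := by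
  simp [cnoidalWave, jacobiCn, jacobiAm_zero (cnoidal_param_lt_one h32 h21)]

theorem cnoidalSlope_zero (h32 : e₃ < e₂) (h21 : e₂ < e₁) : cnoidalSlope e₁ e₂ e₃ 0 = 0 := by
  simp [cnoidalSlope, jacobiAm_zero (cnoidal_param_lt_one h32 h21)]

theorem cnoidalWave_mem_Icc (h21 : e₂ < e₁) (θ : ℝ) :
    cnoidalWave e₁ e₂ e₃ θ ∈ Set.Icc e₂ e₁ := by
  unfold cnoidalWave jacobiCn
  set x := jacobiAm ((e₁ - e₂) / (e₁ - e₃)) (Real.sqrt ((e₁ - e₃) / 6) * θ)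
  constructor
  · nlinarith [sq_nonneg (Real.cos x)]
  · nlinarith [Real.cos_sq_le_one x]

theorem exists_cnoidalWave_eq_min (h32 : e₃ < e₂) (h21 : e₂ < e₁) :
    ∃ θ, cnoidalWave e₁ e₂ e₃ θ = e₂ := by
  have hw : 0 < Real.sqrt ((e₁ - e₃) / 6) := Real.sqrt_pos.2 (by linarith)
  refine ⟨ellipticIntegralF ((e₁ - e₂) / (e₁ - e₃)) (Real.pi / 2) / Real.sqrt ((e₁ - e₃) / 6), ?_⟩
  unfold cnoidalWave jacobiCn
  rw [mul_div_cancel₀ _ hw.ne', jacobiAm_ellipticIntegralF (cnoidal_param_lt_one h32 h21)]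
  simp

theorem oscillationAmplitude_cnoidalWave (h32 : e₃ < e₂) (h21 : e₂ < e₁) :
    oscillationAmplitude (cnoidalWave e₁ e₂ e₃) = e₁ - e₂ := by
  obtain ⟨θ, hθ⟩ := exists_cnoidalWave_eq_min h32 h21
  have hmax : IsGreatest (Set.range (cnoidalWave e₁ e₂ e₃)) e₁ :=
    ⟨⟨0, cnoidalWave_zero h32 h21⟩, by rintro _ ⟨t, rfl⟩; exact (cnoidalWave_mem_Icc h21 t).2⟩
  have hmin : IsLeast (Set.range (cnoidalWave e₁ e₂ e₃)) e₂ :=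
    ⟨⟨θ, hθ⟩, by rintro _ ⟨t, rfl⟩; exact (cnoidalWave_mem_Icc h21 t).1⟩
  rw [oscillationAmplitude, hmax.csSup_eq, hmin.csInf_eq]

/-- The maximum e₁ is attained only where cos² = 1, that is, where the amplitude is a multiple of π;
a period must carry 0 to such a point. Conversely, cos² has period π. -/
theorem periodic_cnoidalWave_iff (h32 : e₃ < e₂) (h21 : e₂ < e₁) (S : ℝ) :
    Function.Periodic (cnoidalWave e₁ e₂ e₃) S ↔
      ∃ j : ℤ, Real.sqrt ((e₁ - e₃) / 6) * S = j * ellipticK ((e₁ - e₂) / (e₁ - e₃)) := by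
  have h0 := (cnoidal_param_pos h32 h21).le
  have h1 := cnoidal_param_lt_one h32 h21
  constructor
  · intro h
    have hS : cnoidalWave e₁ e₂ e₃ S = e₁ := by
      simpa [cnoidalWave_zero h32 h21] using h 0
    unfold cnoidalWave jacobiCn at hS
    set φ := jacobiAm ((e₁ - e₂) / (e₁ - e₃)) (Real.sqrt ((e₁ - e₃) / 6) * S) with hφ
    have hc : Real.cos φ ^ 2 = 1 := by
      have : (e₁ - e₂) * (Real.cos φ ^ 2 - 1) = 0 := by linarith
      rcases mul_eq_zero.1 this with h | h <;> linarith
    have hsin : Real.sin φ = 0 := by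
      have := Real.sin_sq φ
      rw [hc, sub_self] at this
      exact pow_eq_zero_iff two_ne_zero |>.1 this
    obtain ⟨j, hj⟩ := Real.sin_eq_zero_iff.1 hsin
    refine ⟨j, ?_⟩
    rw [← ellipticIntegralF_int_mul_pi h1, hj, hφ, ellipticIntegralF_jacobiAm h0 h1]
  · rintro ⟨j, hj⟩ θ
    unfold cnoidalWave jacobiCn
    rw [mul_add, hj, jacobiAm_add_int_mul h0 h1, Real.cos_sq, Real.cos_sq (jacobiAm _ _), mul_add 2,
      show 2 * ((j : ℝ) * Real.pi) = j * (2 * Real.pi) by ring, Real.cos_add_int_mul_two_pi]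

theorem hasMinimalPeriod_cnoidalWave (h32 : e₃ < e₂) (h21 : e₂ < e₁) {T : ℝ}
    (hT : Real.sqrt ((e₁ - e₃) / 6) * T = ellipticK ((e₁ - e₂) / (e₁ - e₃))) :
    HasMinimalPeriod (cnoidalWave e₁ e₂ e₃) T := by
  have hw : 0 < Real.sqrt ((e₁ - e₃) / 6) := Real.sqrt_pos.2 (by linarith)
  have hK : 0 < ellipticK ((e₁ - e₂) / (e₁ - e₃)) := Real.pi_pos.trans_le
    (pi_le_ellipticK (cnoidal_param_pos h32 h21).le (cnoidal_param_lt_one h32 h21))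
  refine ⟨⟨pos_of_mul_pos_right (hT ▸ hK) hw.le,
    (periodic_cnoidalWave_iff h32 h21 T).2 ⟨1, by rw [hT, Int.cast_one, one_mul]⟩⟩, ?_⟩
  rintro S ⟨hS, hper⟩
  obtain ⟨j, hj⟩ := (periodic_cnoidalWave_iff h32 h21 S).1 hper
  have hj0 : (0 : ℝ) < j := pos_of_mul_pos_left (hj ▸ mul_pos hw hS) hK.le
  have hj1 : (1 : ℝ) ≤ j := by
    have : 0 < j := by exact_mod_cast hj0
    exact_mod_cast this
  refine le_of_mul_le_mul_left ?_ hw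
  rw [hT, hj]
  nlinarith

/-- Substitute φ = am(wθ), dφ = wΔ dθ. The wave equals e₃ + (e₁ - e₃)Δ² in terms of φ, so the
integrand becomes e₃Δ⁻¹ + (e₁ - e₃)Δ. -/
theorem integral_cnoidalWave (h32 : e₃ < e₂) (h21 : e₂ < e₁) {S : ℝ} {j : ℤ}
    (hj : Real.sqrt ((e₁ - e₃) / 6) * S = j * ellipticK ((e₁ - e₂) / (e₁ - e₃))) :
    Real.sqrt ((e₁ - e₃) / 6) * ∫ θ in (0 : ℝ)..S, cnoidalWave e₁ e₂ e₃ θ =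
      j * (e₃ * ellipticK ((e₁ - e₂) / (e₁ - e₃)) +
        (e₁ - e₃) * ellipticE ((e₁ - e₂) / (e₁ - e₃))) := by
  have h0 := (cnoidal_param_pos h32 h21).le
  have h1 := cnoidal_param_lt_one h32 h21
  have hL : 0 < e₁ - e₃ := by linarith
  have hm : (e₁ - e₂) / (e₁ - e₃) * (e₁ - e₃) = e₁ - e₂ := div_mul_cancel₀ _ hL.ne'
  have hcw : Continuous (cnoidalWave e₁ e₂ e₃) := (contDiff_cnoidalWave h32 h21).continuous
  unfold cnoidalWave jacobiCn at *
  set m := (e₁ - e₂) / (e₁ - e₃)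
  set w := Real.sqrt ((e₁ - e₃) / 6)
  set h : ℝ → ℝ := fun φ => e₃ * (ellipticDelta m φ)⁻¹ + (e₁ - e₃) * ellipticDelta m φ with hh
  have hD := continuous_ellipticDelta m
  have hDi := continuous_inv_ellipticDelta h1
  have hc : Continuous h := (hDi.const_mul _).add (hD.const_mul _)
  have hval : ∀ φ, h φ * ellipticDelta m φ = e₂ + (e₁ - e₂) * Real.cos φ ^ 2 := fun φ => by
    have hp := ellipticDelta_pos h1 φ
    have hs := ellipticDelta_sq h1 φ
    have : h φ * ellipticDelta m φ = e₃ + (e₁ - e₃) * ellipticDelta m φ ^ 2 := by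
      simp only [hh]
      field_simp
    rw [this, hs, Real.sin_sq, mul_sub, ← mul_assoc, mul_comm (e₁ - e₃) m, hm]
    ring
  have hd : ∀ θ, HasDerivAt (fun θ => ∫ φ in (0 : ℝ)..jacobiAm m (w * θ), h φ)
      (w * (e₂ + (e₁ - e₂) * Real.cos (jacobiAm m (w * θ)) ^ 2)) θ := fun θ => by
    have := (hc.integral_hasStrictDerivAt 0 (jacobiAm m (w * θ))).hasDerivAt.comp θ
      (hasDerivAt_jacobiAm_const_mul h0 h1 w θ)
    refine this.congr_deriv ?_
    rw [← hval]
    ring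
  have hI := intervalIntegral.integral_eq_sub_of_hasDerivAt (a := 0) (b := S) (fun θ _ => hd θ)
    ((hcw.const_mul w).intervalIntegrable _ _)
  have hS : jacobiAm m (w * S) = j * Real.pi := by
    rw [hj]
    simpa [jacobiAm_zero h1] using jacobiAm_add_int_mul h0 h1 0 j
  rw [hS, mul_zero, jacobiAm_zero h1, intervalIntegral.integral_same, sub_zero,
    integral_zero_int_mul_pi (fun t => by simp [hh, ellipticDelta_add_pi]) hc,
    intervalIntegral.integral_const_mul] at hI
  rw [hI, hh, intervalIntegral.integral_add ((hDi.const_mul _).intervalIntegrable _ _)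
    ((hD.const_mul _).intervalIntegrable _ _), intervalIntegral.integral_const_mul,
    intervalIntegral.integral_const_mul, ← ellipticK, ← ellipticE]

/-- The roots are determined by the parameter when the wave has period `2π / k` and mean zero. -/
theorem cnoidal_roots_of_period_of_flux (h32 : e₃ < e₂) (h21 : e₂ < e₁) (hs : e₁ + e₂ + e₃ = -6)
    {k : ℝ} {m : ℝ} (hm : m = (e₁ - e₂) / (e₁ - e₃))
    (hk : Real.sqrt ((e₁ - e₃) / 6) * (2 * Real.pi) = k * ellipticK m)
    (hflux : e₃ * ellipticK m + (e₁ - e₃) * ellipticE m = 0) :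
    k ^ 2 * periodFluxFunction m = 4 * Real.pi ^ 2 ∧
      e₁ - e₃ = 3 * k ^ 2 * ellipticK m ^ 2 / (2 * Real.pi ^ 2) := by
  have hpi := Real.pi_pos
  have hw : Real.sqrt ((e₁ - e₃) / 6) ^ 2 = (e₁ - e₃) / 6 := Real.sq_sqrt (by linarith)
  have hL : 0 < e₁ - e₃ := by linarith
  have hmL : m * (e₁ - e₃) = e₁ - e₂ := hm ▸ div_mul_cancel₀ _ hL.ne'
  have hK : 0 < ellipticK m := hm ▸ Real.pi_pos.trans_le
    (pi_le_ellipticK (cnoidal_param_pos h32 h21).le (cnoidal_param_lt_one h32 h21))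
  have h2 : k ^ 2 * ellipticK m ^ 2 = (e₁ - e₃) / 6 * (4 * Real.pi ^ 2) := by
    rw [← hw, ← mul_pow, ← hk]; ring
  refine ⟨?_, ?_⟩
  -- The flux condition and the sum of the roots eliminate e₃; the period condition then eliminates
  -- e₁ - e₃.
  · have h3 : (e₁ - e₃) * (3 * ellipticE m - (2 - m) * ellipticK m) = 6 * ellipticK m := by
      linear_combination 3 * hflux + ellipticK m * hmL - ellipticK m * hs
    apply mul_right_cancel₀ hK.ne'
    unfold periodFluxFunction
    linear_combination (3 * ellipticE m - (2 - m) * ellipticK m) * h2 + 4 * Real.pi ^ 2 / 6 * h3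
  · rw [eq_div_iff (by positivity)]
    linarith

end cnoidalWave

theorem exists_cnoidal_roots {k m : ℝ} (hk : 0 < k) (h0 : 0 < m) (h1 : m < 1)
    (hG : k ^ 2 * periodFluxFunction m = 4 * Real.pi ^ 2) :
    ∃ e₁ e₂ e₃ : ℝ, e₃ < e₂ ∧ e₂ < e₁ ∧ e₁ + e₂ + e₃ = -6 ∧ (e₁ - e₂) / (e₁ - e₃) = m ∧
      Real.sqrt ((e₁ - e₃) / 6) * (2 * Real.pi) = k * ellipticK m ∧
      e₃ * ellipticK m + (e₁ - e₃) * ellipticE m = 0 ∧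
      e₁ - e₂ = m * (3 * k ^ 2 * ellipticK m ^ 2 / (2 * Real.pi ^ 2)) := by
  have hpi := Real.pi_pos
  have hK : 0 < ellipticK m := Real.pi_pos.trans_le (pi_le_ellipticK h0.le h1)
  -- L is forced by the period condition, and e₃ below by 3e₃ + (2 - m)L = -6.
  obtain ⟨L, hL⟩ : ∃ L, L = 3 * k ^ 2 * ellipticK m ^ 2 / (2 * Real.pi ^ 2) := ⟨_, rfl⟩
  have hLpos : 0 < L := by rw [hL]; positivity
  obtain ⟨e₃, he₃⟩ : ∃ e, e = -2 - (2 - m) * L / 3 := ⟨_, rfl⟩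
  refine ⟨e₃ + L, e₃ + (1 - m) * L, e₃, by nlinarith, by nlinarith, by rw [he₃]; ring, ?_, ?_, ?_,
    by rw [← hL]; ring⟩
  · rw [div_eq_iff (by linarith)]
    ring
  · have : (e₃ + L - e₃) / 6 = (k * ellipticK m / (2 * Real.pi)) ^ 2 := by
      rw [hL]; field_simp; ring
    rw [this, Real.sqrt_sq (by positivity)]
    field_simp
  · unfold periodFluxFunction at hG
    have h2 : 2 * Real.pi ^ 2 * L = 3 * k ^ 2 * ellipticK m ^ 2 := by rw [hL]; field_simp
    have h3 : 2 * Real.pi ^ 2 * 3 * (e₃ * ellipticK m + (e₃ + L - e₃) * ellipticE m) = 0 := by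
      rw [he₃]
      linear_combination (3 * ellipticE m - (2 - m) * ellipticK m) * h2 + 3 * ellipticK m * hG
    have : 2 * Real.pi ^ 2 * 3 ≠ 0 := by positivity
    exact (mul_eq_zero.1 h3).resolve_left this

/-! ### Periodic solutions of the second-order equation -/

theorem Function.Periodic.of_hasDerivAt {g g' : ℝ → ℝ} {T : ℝ} (hg : Function.Periodic g T)
    (h : ∀ t, HasDerivAt g (g' t) t) : Function.Periodic g' T := fun t => by
  have h1 := (h (t + T)).comp_add_const t T
  rw [show (fun x => g (x + T)) = g from funext hg] at h1
  exact h1.unique (h t)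

theorem Function.Periodic.eq_of_monotone {R : ℝ → ℝ} {T : ℝ} (hT : 0 < T)
    (hR : Function.Periodic R T) (hm : Monotone R) (x y : ℝ) : R x = R y := by
  wlog hxy : x ≤ y generalizing x y
  · exact (this y x (le_of_not_ge hxy)).symm
  obtain ⟨n, hn⟩ := exists_nat_ge ((y - x) / T)
  refine le_antisymm (hm hxy) ?_
  have : y ≤ x + n * T := by rw [div_le_iff₀ hT] at hn; linarith
  exact (hm this).trans_eq (hR.nat_mul n x)

/-- Derivative of the energy along `f'' = v f' - f² - 4 f - d`. -/
theorem hasDerivAt_energy {f f' : ℝ → ℝ} {v d : ℝ} (hf : ∀ t, HasDerivAt f (f' t) t)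
    (hf' : ∀ t, HasDerivAt f' (v * f' t - f t ^ 2 - 4 * f t - d) t) (t : ℝ) :
    HasDerivAt (fun t => f' t ^ 2 / 2 + f t ^ 3 / 3 + 2 * f t ^ 2 + d * f t) (v * f' t ^ 2) t := by
  refine (((((hf' t).pow 2).div_const 2).add (((hf t).pow 3).div_const 3)).add
    (((hf t).pow 2).const_mul 2) |>.add ((hf t).const_mul d)).congr_deriv ?_
  norm_num
  ring

theorem deriv_eq_zero_of_damped_periodic {f f' : ℝ → ℝ} {v d T : ℝ} (hT : 0 < T) (hv : v ≠ 0)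
    (hper : Function.Periodic f T) (hf : ∀ t, HasDerivAt f (f' t) t)
    (hf' : ∀ t, HasDerivAt f' (v * f' t - f t ^ 2 - 4 * f t - d) t) (t : ℝ) : f' t = 0 := by
  -- Dividing the energy by v makes its derivative f'² ≥ 0 whatever the sign of v; a monotone
  -- periodic function is constant.
  set R : ℝ → ℝ := fun t => (f' t ^ 2 / 2 + f t ^ 3 / 3 + 2 * f t ^ 2 + d * f t) / v with hR
  have hd : ∀ t, HasDerivAt R (f' t ^ 2) t := fun t =>
    ((hasDerivAt_energy hf hf' t).div_const v).congr_deriv (by field_simp)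
  have hm : Monotone R := monotone_of_deriv_nonneg (fun t => (hd t).differentiableAt) fun t => by
    rw [(hd t).deriv]; positivity
  have hp : Function.Periodic R T := fun t => by
    simp only [hR, hper t, hper.of_hasDerivAt hf t]
  have hc : R = fun _ => R 0 := funext fun t => hp.eq_of_monotone hT hm t 0
  have h0 := hd t
  rw [hc] at h0
  exact pow_eq_zero_iff two_ne_zero |>.1 (h0.unique (hasDerivAt_const t (R 0)))

/-- The quadratic field is not globally Lipschitz, but on the strip where the first coordinate is at
most M in absolute value it is, with constant 2M + 4. -/
theorem eq_of_hasDerivAt_of_bounded {f f' g g' : ℝ → ℝ} {d M t₀ : ℝ}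
    (hf : ∀ t, HasDerivAt f (f' t) t) (hf' : ∀ t, HasDerivAt f' (-f t ^ 2 - 4 * f t - d) t)
    (hg : ∀ t, HasDerivAt g (g' t) t) (hg' : ∀ t, HasDerivAt g' (-g t ^ 2 - 4 * g t - d) t)
    (hfM : ∀ t, |f t| ≤ M) (hgM : ∀ t, |g t| ≤ M) (h0 : f t₀ = g t₀) (h0' : f' t₀ = g' t₀) :
    f = g := by
  have hM : 0 ≤ M := (abs_nonneg _).trans (hfM 0)
  have hlip : LipschitzOnWith (Real.toNNReal (2 * M + 4))
      (fun z : ℝ × ℝ => (z.2, -z.1 ^ 2 - 4 * z.1 - d)) {z | |z.1| ≤ M} := by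
    refine LipschitzOnWith.of_dist_le_mul fun x hx y hy => ?_
    rw [Real.coe_toNNReal _ (by linarith), Prod.dist_eq, Prod.dist_eq]
    have h1 : dist x.1 y.1 ≤ max (dist x.1 y.1) (dist x.2 y.2) := le_max_left _ _
    have h2 : dist x.2 y.2 ≤ max (dist x.1 y.1) (dist x.2 y.2) := le_max_right _ _
    have h3 : (0 : ℝ) ≤ dist x.2 y.2 := dist_nonneg
    refine max_le (by nlinarith) ?_
    have : dist (-x.1 ^ 2 - 4 * x.1 - d) (-y.1 ^ 2 - 4 * y.1 - d) =
        |x.1 + y.1 + 4| * dist x.1 y.1 := by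
      rw [Real.dist_eq, Real.dist_eq, ← abs_mul, ← abs_neg]
      congr 1
      ring
    rw [this]
    refine mul_le_mul ?_ h1 dist_nonneg (by linarith)
    have hx' := abs_le.1 (show |x.1| ≤ M from hx)
    have hy' := abs_le.1 (show |y.1| ≤ M from hy)
    exact abs_le.2 ⟨by linarith, by linarith⟩
  have h := ODE_solution_unique_univ (v := fun _ z => (z.2, -z.1 ^ 2 - 4 * z.1 - d))
    (s := fun _ => {z : ℝ × ℝ | |z.1| ≤ M}) (f := fun t => (f t, f' t)) (g := fun t => (g t, g' t))
    (t₀ := t₀) (fun _ => hlip) (fun t => ⟨(hf t).prodMk (hf' t), hfM t⟩)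
    (fun t => ⟨(hg t).prodMk (hg' t), hgM t⟩) (by simp [h0, h0'])
  exact funext fun t => congrArg Prod.fst (congrFun h t)

/-- Nonconstant periodic solutions of `f'' = -f² - 4 f - d` are rotated cnoidal waves. -/
theorem exists_eq_cnoidalWave {f f' : ℝ → ℝ} {d T : ℝ} (hT : 0 < T)
    (hper : Function.Periodic f T) (hf : ∀ t, HasDerivAt f (f' t) t)
    (hf' : ∀ t, HasDerivAt f' (-f t ^ 2 - 4 * f t - d) t) (hne : ∃ s t, f s ≠ f t) :
    ∃ e₁ e₂ e₃ θ₀ : ℝ, e₃ < e₂ ∧ e₂ < e₁ ∧ e₁ + e₂ + e₃ = -6 ∧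
      ∀ θ, f θ = cnoidalWave e₁ e₂ e₃ (θ - θ₀) := by
  have hc : Continuous f := continuous_iff_continuousAt.2 fun t => (hf t).continuousAt
  have hcomp : IsCompact (Set.range f) := hper.compact_of_continuous hT.ne' hc
  obtain ⟨_, ⟨θ₀, rfl⟩, hmax⟩ := hcomp.exists_isGreatest (Set.range_nonempty f)
  obtain ⟨_, ⟨θ₁, rfl⟩, hmin⟩ := hcomp.exists_isLeast (Set.range_nonempty f)
  replace hmax : ∀ t, f t ≤ f θ₀ := fun t => hmax ⟨t, rfl⟩
  replace hmin : ∀ t, f θ₁ ≤ f t := fun t => hmin ⟨t, rfl⟩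
  have h0 : f' θ₀ = 0 :=
    IsLocalMax.hasDerivAt_eq_zero (Filter.Eventually.of_forall hmax) (hf θ₀)
  have h1 : f' θ₁ = 0 :=
    IsLocalMin.hasDerivAt_eq_zero (Filter.Eventually.of_forall hmin) (hf θ₁)
  have h21 : f θ₁ < f θ₀ := by
    obtain ⟨s, t, hst⟩ := hne
    refine lt_of_le_of_ne (hmin θ₀) fun h => hst ?_
    rw [le_antisymm (h ▸ hmax s) (hmin s), le_antisymm (h ▸ hmax t) (hmin t)]
  have hen : ∀ s t, f' s ^ 2 / 2 + f s ^ 3 / 3 + 2 * f s ^ 2 + d * f s =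
      f' t ^ 2 / 2 + f t ^ 3 / 3 + 2 * f t ^ 2 + d * f t := by
    have hd := hasDerivAt_energy (v := 0) hf fun t => (hf' t).congr_deriv (by ring)
    exact is_const_of_deriv_eq_zero (fun t => (hd t).differentiableAt) fun t => by
      rw [(hd t).deriv, zero_mul]
  obtain ⟨e₁, he₁⟩ : ∃ e, e = f θ₀ := ⟨_, rfl⟩
  obtain ⟨e₂, he₂⟩ : ∃ e, e = f θ₁ := ⟨_, rfl⟩
  obtain ⟨e₃, he₃⟩ : ∃ e, e = -6 - e₁ - e₂ := ⟨_, rfl⟩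
  rw [← he₁] at hmax h21
  rw [← he₂] at hmin h21
  have hM : ∀ x ∈ Set.Icc e₂ e₁, |x| ≤ max |e₁| |e₂| := fun x hx => by
    rw [max_comm]
    exact abs_le_max_abs_abs hx.1 hx.2
  -- Equal energies at a maximum and a minimum, where f' = 0, determine d after division by e₁ - e₂.
  have hd : d = (e₁ * e₂ + e₂ * e₃ + e₃ * e₁) / 3 := by
    have h := hen θ₀ θ₁
    rw [h0, h1, ← he₁, ← he₂] at h
    apply mul_left_cancel₀ (sub_pos.2 h21).ne'
    rw [he₃]
    linear_combination h
  have hcubic : ∀ t, 3 * f' t ^ 2 = 2 * ((e₁ - f t) * (f t - e₂) * (f t - e₃)) := fun t => by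
    have h := hen t θ₀
    rw [h0, ← he₁, hd] at h
    rw [he₃] at h ⊢
    linear_combination 6 * h
  -- Otherwise f takes a value strictly between e₂ and min(e₁, e₃), where the cubic is negative,
  -- against f'² ≥ 0.
  have hle : e₃ ≤ e₂ := by
    by_contra! hlt
    obtain ⟨x, hx1, hx2⟩ := exists_between (lt_min h21 hlt)
    obtain ⟨t, rfl⟩ := mem_range_of_exists_le_of_exists_ge hc ⟨θ₁, he₂ ▸ hx1.le⟩
      ⟨θ₀, he₁ ▸ (hx2.trans_le (min_le_left _ _)).le⟩
    have h := hcubic t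
    have := mul_pos (mul_pos (sub_pos.2 (hx2.trans_le (min_le_left _ _))) (sub_pos.2 hx1))
      (sub_pos.2 (hx2.trans_le (min_le_right _ _)))
    nlinarith [sq_nonneg (f' t)]
  -- A double root e₂ would be an equilibrium that f meets with zero slope, so uniqueness would make
  -- f constant.
  have h32 : e₃ < e₂ := by
    refine lt_of_le_of_ne hle fun h => ?_
    have : f = fun _ => e₂ := eq_of_hasDerivAt_of_bounded (g' := fun _ => 0) (t₀ := θ₁)
      (M := max |e₁| |e₂|) hf hf' (fun t => hasDerivAt_const t _)
      (fun t => (hasDerivAt_const t (0 : ℝ)).congr_deriv (by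
        rw [hd, h]
        have : e₁ = -6 - 2 * e₂ := by linarith
        rw [this]
        ring)) (fun t => hM _ ⟨hmin t, hmax t⟩) (fun t => le_max_right _ _) he₂.symm h1
    obtain ⟨s, t, hst⟩ := hne
    exact hst (by rw [this])
  have hs : e₁ + e₂ + e₃ = -6 := by linarith
  refine ⟨e₁, e₂, e₃, θ₀, h32, h21, hs, congrFun ?_⟩
  refine eq_of_hasDerivAt_of_bounded (g' := fun θ => cnoidalSlope e₁ e₂ e₃ (θ - θ₀)) (t₀ := θ₀)
      (M := max |e₁| |e₂|) hf hf' (fun t => (hasDerivAt_cnoidalWave h32 h21 _).comp_sub_const t θ₀)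
      (fun t => ((hasDerivAt_cnoidalSlope h32 h21 hs _).comp_sub_const t θ₀).congr_deriv
        (by rw [hd])) (fun t => hM _ ⟨hmin t, hmax t⟩)
      (fun t => hM _ (cnoidalWave_mem_Icc h21 _)) ?_ ?_
  · rw [sub_self, cnoidalWave_zero h32 h21, he₁]
  · simp [cnoidalSlope_zero h32 h21, h0]

/-! ### Zero-flux waves: existence, uniqueness, amplitude -/

/-- Averaging `g'' = -g² - 4 g - d` for a periodic `g` of mean zero determines `d`. -/
theorem eq_neg_integral_sq_of_periodic {g g' : ℝ → ℝ} {d : ℝ}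
    (hper : Function.Periodic g (2 * Real.pi)) (hg : ∀ t, HasDerivAt g (g' t) t)
    (hg' : ∀ t, HasDerivAt g' (-g t ^ 2 - 4 * g t - d) t) (hflux : ZeroFlux g) :
    d = -(1 / (2 * Real.pi) * ∫ t in (0 : ℝ)..(2 * Real.pi), g t ^ 2) := by
  have hc : Continuous g := continuous_iff_continuousAt.2 fun t => (hg t).continuousAt
  have hI := intervalIntegral.integral_eq_sub_of_hasDerivAt (a := 0) (b := 2 * Real.pi)
    (fun t _ => hg' t) (Continuous.intervalIntegrable (by fun_prop) _ _)
  have hp := hper.of_hasDerivAt hg 0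
  rw [zero_add] at hp
  rw [hp, sub_self, intervalIntegral.integral_sub (Continuous.intervalIntegrable (by fun_prop) _ _)
    (Continuous.intervalIntegrable (by fun_prop) _ _),
    intervalIntegral.integral_sub (Continuous.intervalIntegrable (by fun_prop) _ _)
    (Continuous.intervalIntegrable (by fun_prop) _ _), intervalIntegral.integral_neg,
    intervalIntegral.integral_const_mul, show ∫ t in (0 : ℝ)..(2 * Real.pi), g t = 0 from hflux,
    intervalIntegral.integral_const] at hI
  have := Real.pi_pos
  simp only [sub_zero, mul_zero, smul_eq_mul] at hI
  field_simp
  linarith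

/-- The conditions on the roots under which `cnoidalWave` has mean zero and `2π` is `k` times its
minimal period. -/
structure IsZeroFluxCnoidal (k e₁ e₂ e₃ : ℝ) : Prop where
  lt₃₂ : e₃ < e₂
  lt₂₁ : e₂ < e₁
  sum_eq : e₁ + e₂ + e₃ = -6
  period : Real.sqrt ((e₁ - e₃) / 6) * (2 * Real.pi) = k * ellipticK ((e₁ - e₂) / (e₁ - e₃))
  flux : e₃ * ellipticK ((e₁ - e₂) / (e₁ - e₃)) +
    (e₁ - e₃) * ellipticE ((e₁ - e₂) / (e₁ - e₃)) = 0

namespace IsZeroFluxCnoidal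

variable {k e₁ e₂ e₃ e₁' e₂' e₃' : ℝ}

theorem pos (h : IsZeroFluxCnoidal k e₁ e₂ e₃) : 0 < k := by
  have hw : 0 < Real.sqrt ((e₁ - e₃) / 6) :=
    Real.sqrt_pos.2 (by linarith [h.lt₃₂, h.lt₂₁])
  have hK := Real.pi_pos.trans_le (pi_le_ellipticK (cnoidal_param_pos h.lt₃₂ h.lt₂₁).le
    (cnoidal_param_lt_one h.lt₃₂ h.lt₂₁))
  exact pos_of_mul_pos_left (h.period ▸ mul_pos hw Real.two_pi_pos) hK.le

/-- Here m > 0, so G(m) < G(0) = π² and 4π² = k²G(m) < k²π². -/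
theorem two_lt (h : IsZeroFluxCnoidal k e₁ e₂ e₃) : 2 < k := by
  have hG := (cnoidal_roots_of_period_of_flux h.lt₃₂ h.lt₂₁ h.sum_eq rfl h.period h.flux).1
  have h0 := cnoidal_param_pos h.lt₃₂ h.lt₂₁
  have h1 := cnoidal_param_lt_one h.lt₃₂ h.lt₂₁
  have hlt := strictAntiOn_periodFluxFunction ⟨le_rfl, one_pos⟩ ⟨h0.le, h1⟩ h0
  rw [periodFluxFunction_zero] at hlt
  have hk := h.pos
  have hpi : 0 < Real.pi ^ 2 := pow_pos Real.pi_pos 2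
  by_contra! hle
  have : k ^ 2 ≤ 4 := by nlinarith
  nlinarith [pow_pos hk 2]

/-- Injectivity of G recovers m from k; then m gives e₁ - e₃ and e₁ - e₂, and the sum fixes the
roots. -/
theorem unique (h : IsZeroFluxCnoidal k e₁ e₂ e₃) (h' : IsZeroFluxCnoidal k e₁' e₂' e₃') :
    e₁ = e₁' ∧ e₂ = e₂' ∧ e₃ = e₃' := by
  obtain ⟨hG, hL⟩ := cnoidal_roots_of_period_of_flux h.lt₃₂ h.lt₂₁ h.sum_eq rfl h.period h.flux
  obtain ⟨hG', hL'⟩ :=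
    cnoidal_roots_of_period_of_flux h'.lt₃₂ h'.lt₂₁ h'.sum_eq rfl h'.period h'.flux
  have hm : (e₁ - e₂) / (e₁ - e₃) = (e₁' - e₂') / (e₁' - e₃') := by
    refine strictAntiOn_periodFluxFunction.injOn
      ⟨(cnoidal_param_pos h.lt₃₂ h.lt₂₁).le, cnoidal_param_lt_one h.lt₃₂ h.lt₂₁⟩
      ⟨(cnoidal_param_pos h'.lt₃₂ h'.lt₂₁).le, cnoidal_param_lt_one h'.lt₃₂ h'.lt₂₁⟩ ?_
    exact mul_left_cancel₀ (pow_pos h.pos 2).ne' (hG.trans hG'.symm)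
  have hL2 : e₁ - e₃ = e₁' - e₃' := by rw [hL, hL', hm]
  have hm2 : e₁ - e₂ = e₁' - e₂' := by
    have h0 : e₁' - e₃' ≠ 0 := by linarith [h'.lt₃₂, h'.lt₂₁]
    rw [hL2, div_left_inj' h0] at hm
    exact hm
  have := h.sum_eq
  have := h'.sum_eq
  refine ⟨?_, ?_, ?_⟩ <;> linarith

theorem hasMinimalPeriod (h : IsZeroFluxCnoidal k e₁ e₂ e₃) :
    HasMinimalPeriod (cnoidalWave e₁ e₂ e₃) (2 * Real.pi / k) := by
  have hk := h.pos
  refine hasMinimalPeriod_cnoidalWave h.lt₃₂ h.lt₂₁ ?_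
  rw [mul_div_assoc', h.period]
  field_simp

end IsZeroFluxCnoidal

theorem IsZeroFluxCnoidal.periodic {k : ℕ} {e₁ e₂ e₃ : ℝ} (h : IsZeroFluxCnoidal k e₁ e₂ e₃) :
    Function.Periodic (cnoidalWave e₁ e₂ e₃) (2 * Real.pi) :=
  (periodic_cnoidalWave_iff h.lt₃₂ h.lt₂₁ _).2 ⟨k, by exact_mod_cast h.period⟩

theorem IsZeroFluxCnoidal.zeroFlux {k : ℕ} {e₁ e₂ e₃ : ℝ} (h : IsZeroFluxCnoidal k e₁ e₂ e₃) :
    ZeroFlux (cnoidalWave e₁ e₂ e₃) := by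
  have hI := integral_cnoidalWave h.lt₃₂ h.lt₂₁ (S := 2 * Real.pi) (j := k)
    (by exact_mod_cast h.period)
  rw [h.flux, mul_zero] at hI
  exact (mul_eq_zero.1 hI).resolve_left
    (Real.sqrt_pos.2 (by linarith [h.lt₃₂, h.lt₂₁])).ne'

/-- A cnoidal wave of period `2π` and mean zero. -/
theorem exists_isZeroFluxCnoidal {e₁ e₂ e₃ : ℝ} (h32 : e₃ < e₂) (h21 : e₂ < e₁)
    (hs : e₁ + e₂ + e₃ = -6) (hper : Function.Periodic (cnoidalWave e₁ e₂ e₃) (2 * Real.pi))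
    (hflux : ZeroFlux (cnoidalWave e₁ e₂ e₃)) :
    ∃ k : ℕ, 3 ≤ k ∧ IsZeroFluxCnoidal k e₁ e₂ e₃ := by
  obtain ⟨j, hj⟩ := (periodic_cnoidalWave_iff h32 h21 _).1 hper
  have hI := integral_cnoidalWave h32 h21 hj
  rw [show ∫ θ in (0 : ℝ)..(2 * Real.pi), cnoidalWave e₁ e₂ e₃ θ = 0 from hflux, mul_zero] at hI
  have hj0 : (j : ℝ) ≠ 0 := fun h0 => by
    rw [h0, zero_mul] at hj
    exact (mul_pos (Real.sqrt_pos.2 (by linarith : 0 < (e₁ - e₃) / 6)) Real.two_pi_pos).ne' hj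
  -- The structure takes a real k, so it applies to the integer j before its sign is known; `two_lt`
  -- then gives j ≥ 3.
  have h : IsZeroFluxCnoidal j e₁ e₂ e₃ :=
    ⟨h32, h21, hs, hj, (mul_eq_zero.1 hI.symm).resolve_left hj0⟩
  have h2 : 2 < j := by exact_mod_cast h.two_lt
  lift j to ℕ using by omega
  exact ⟨j, by omega, by exact_mod_cast h⟩

theorem exists_isZeroFluxCnoidal_amplitude_bounds :
    ∃ a A : ℝ, 0 < a ∧ 0 < A ∧ ∀ k : ℕ, 3 ≤ k → ∃ e₁ e₂ e₃ : ℝ, IsZeroFluxCnoidal k e₁ e₂ e₃ ∧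
      a * (k : ℝ) ^ 2 ≤ e₁ - e₂ ∧ e₁ - e₂ ≤ A * (k : ℝ) ^ 2 := by
  obtain ⟨M, hM1, hM⟩ := exists_cnoidal_parameter
  obtain ⟨m₃, h30, h3M, hG3⟩ := hM 3 le_rfl
  have hpi := Real.pi_pos
  have hM' : 0 < 1 - M := by linarith
  -- From the amplitude 3mk²K²/(2π²): below, m ≥ m₃ and K ≥ π; above, m ≤ 1 and K² ≤ π²/(1 - M).
  refine ⟨m₃ * (3 / 2), 3 / (2 * (1 - M)), by positivity, by positivity, fun k hk => ?_⟩
  obtain ⟨m, h0, hmM, hG⟩ := hM k hk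
  have h1 : m < 1 := hmM.trans hM1
  have hk3 : (3 : ℝ) ≤ k := by exact_mod_cast hk
  obtain ⟨e₁, e₂, e₃, h32, h21, hs, hm, hp, hf, hamp⟩ :=
    exists_cnoidal_roots (by linarith) h0 h1 hG
  refine ⟨e₁, e₂, e₃, ⟨h32, h21, hs, by rw [hm]; exact hp, by rw [hm]; exact hf⟩, ?_⟩
  -- Larger k means smaller G(m), hence larger m, so k = 3 gives the least parameter.
  have hm3 : m₃ ≤ m := by
    refine (strictAntiOn_periodFluxFunction.le_iff_ge ⟨h0.le, h1⟩ ⟨h30.le, h3M.trans hM1⟩).1 ?_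
    have hpos : 0 < periodFluxFunction m := by
      refine pos_of_mul_pos_right (hG ▸ ?_ : 0 < (k : ℝ) ^ 2 * periodFluxFunction m) (by positivity)
      positivity
    have : (3 : ℝ) ^ 2 ≤ (k : ℝ) ^ 2 := pow_le_pow_left₀ (by norm_num) hk3 2
    have hG3' : (3 : ℝ) ^ 2 * periodFluxFunction m₃ = 4 * Real.pi ^ 2 := by exact_mod_cast hG3
    nlinarith
  have hKge := pi_le_ellipticK h0.le h1
  have hK0 : 0 < ellipticK m := hpi.trans_le hKge
  have hKsq : Real.pi ^ 2 ≤ ellipticK m ^ 2 := pow_le_pow_left₀ hpi.le hKge 2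
  have hKle : ellipticK m ^ 2 ≤ Real.pi ^ 2 / (1 - M) := by
    have h := pow_le_pow_left₀ hK0.le (ellipticK_le h0.le h1) 2
    rw [div_pow, Real.sq_sqrt (by linarith)] at h
    exact h.trans (div_le_div_of_nonneg_left (by positivity) hM' (by linarith))
  rw [hamp]
  constructor
  · have : m₃ * (3 / 2) * (k : ℝ) ^ 2 =
        m₃ * (3 * (k : ℝ) ^ 2 * Real.pi ^ 2 / (2 * Real.pi ^ 2)) := by field_simp
    rw [this]
    gcongr
  · have : 3 / (2 * (1 - M)) * (k : ℝ) ^ 2 =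
        1 * (3 * (k : ℝ) ^ 2 * (Real.pi ^ 2 / (1 - M)) / (2 * Real.pi ^ 2)) := by field_simp
    rw [this]
    gcongr

/-! ### Classification for the reduced system -/

theorem IsReducedSolution.exists_ode {f v p : ℝ → ℝ} (h : IsReducedSolution f v p) :
    ∃ c w : ℝ, (∀ t, v t = w) ∧ (∀ t, p t = 2 * f t + c) ∧
      (∀ t, HasDerivAt f (deriv f t) t) ∧
      ∀ t, HasDerivAt (deriv f) (w * deriv f t - f t ^ 2 - 4 * f t - (w ^ 2 + 2 * c)) t := by
  have hfd : Differentiable ℝ f := h.contDiff_f.differentiable (by norm_num)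
  have hfd' : Differentiable ℝ (deriv f) :=
    (contDiff_succ_iff_deriv.1 (by exact_mod_cast h.contDiff_f :
      ContDiff ℝ (1 + 1) f)).2.2.differentiable (by norm_num)
  have hvd : Differentiable ℝ v := h.contDiff_v.differentiable (by norm_num)
  have hpd : Differentiable ℝ p := h.contDiff_p.differentiable (by norm_num)
  have hv : ∀ t, v t = v 0 := fun t => is_const_of_deriv_eq_zero hvd h.divergence t 0
  have hp : ∀ t, p t = 2 * f t + (p 0 - 2 * f 0) := fun t => by
    have := is_const_of_deriv_eq_zero (hpd.sub (hfd.const_mul 2)) h.tangential t 0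
    simp only [Pi.sub_apply] at this
    linarith
  refine ⟨p 0 - 2 * f 0, v 0, hv, hp, fun t => (hfd t).hasDerivAt, fun t => ?_⟩
  refine (hfd' t).hasDerivAt.congr_deriv ?_
  have hr := h.radial t
  rw [sq_abs, hv t, hp t] at hr
  linarith

theorem isReducedSolution_of_eq_zero {f v p : ℝ → ℝ} (hf : ∀ θ, f θ = 0)
    (hv : ∃ c : ℝ, ∀ θ, v θ = c) (hp : ∀ θ, p θ = -|v θ| ^ 2 / 2) :
    IsReducedSolution f v p ∧ ZeroFlux f := by
  obtain ⟨c, hc⟩ := hv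
  obtain rfl : f = fun _ => 0 := funext hf
  obtain rfl : v = fun _ => c := funext hc
  obtain rfl : p = fun _ => -|c| ^ 2 / 2 := funext hp
  refine ⟨⟨fun _ => rfl, fun _ => rfl, fun _ => rfl, contDiff_const, contDiff_const,
    contDiff_const, fun θ => by simp, fun θ => ?_, fun θ => by simp⟩, by simp [ZeroFlux]⟩
  simp
  ring

theorem IsZeroFluxCnoidal.const_eq {k : ℕ} {e₁ e₂ e₃ : ℝ} (h : IsZeroFluxCnoidal k e₁ e₂ e₃) :
    (e₁ * e₂ + e₂ * e₃ + e₃ * e₁) / 3 =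
      -(1 / (2 * Real.pi) * ∫ t in (0 : ℝ)..(2 * Real.pi), cnoidalWave e₁ e₂ e₃ t ^ 2) :=
  eq_neg_integral_sq_of_periodic h.periodic (hasDerivAt_cnoidalWave h.lt₃₂ h.lt₂₁)
    (hasDerivAt_cnoidalSlope h.lt₃₂ h.lt₂₁ h.sum_eq) h.zeroFlux

theorem ZeroFlux.comp_sub_const_iff {g : ℝ → ℝ} (hg : Function.Periodic g (2 * Real.pi)) (s : ℝ) :
    ZeroFlux (fun θ => g (θ - s)) ↔ ZeroFlux g := by
  unfold ZeroFlux
  rw [intervalIntegral.integral_comp_sub_right g s]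
  have := hg.intervalIntegral_add_eq (0 - s) 0
  rw [zero_add, show 0 - s + 2 * Real.pi = 2 * Real.pi - s by ring] at this
  rw [this]

theorem IsZeroFluxCnoidal.isReducedSolution {k : ℕ} {e₁ e₂ e₃ : ℝ}
    (h : IsZeroFluxCnoidal k e₁ e₂ e₃) {f v p : ℝ → ℝ} {θ₀ : ℝ}
    (hf : ∀ θ, f θ = cnoidalWave e₁ e₂ e₃ (θ - θ₀)) (hv : ∀ θ, v θ = 0)
    (hp : ∀ θ, p θ = 2 * f θ
      - 1 / (4 * Real.pi) * ∫ t in (0 : ℝ)..(2 * Real.pi), cnoidalWave e₁ e₂ e₃ t ^ 2) :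
    IsReducedSolution f v p ∧ ZeroFlux f := by
  obtain rfl : v = fun _ => 0 := funext hv
  have hc := h.const_eq
  set I := ∫ t in (0 : ℝ)..(2 * Real.pi), cnoidalWave e₁ e₂ e₃ t ^ 2
  have hI : 1 / (4 * Real.pi) * I = 1 / (2 * Real.pi) * I / 2 := by ring
  obtain rfl : f = fun θ => cnoidalWave e₁ e₂ e₃ (θ - θ₀) := funext hf
  have hd1 := fun t => (hasDerivAt_cnoidalWave h.lt₃₂ h.lt₂₁ _).comp_sub_const t θ₀
  have hd2 := fun t => (hasDerivAt_cnoidalSlope h.lt₃₂ h.lt₂₁ h.sum_eq _).comp_sub_const t θ₀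
  have hper : Function.Periodic (fun θ => cnoidalWave e₁ e₂ e₃ (θ - θ₀)) (2 * Real.pi) :=
    h.periodic.sub_const θ₀
  have hcd : ContDiff ℝ ∞ fun θ => cnoidalWave e₁ e₂ e₃ (θ - θ₀) :=
    (contDiff_cnoidalWave h.lt₃₂ h.lt₂₁).comp (contDiff_id.sub contDiff_const)
  have hpe : p = fun θ => 2 * cnoidalWave e₁ e₂ e₃ (θ - θ₀) - 1 / (4 * Real.pi) * I := funext hp
  refine ⟨⟨hper, fun _ => rfl, fun θ => ?_, contDiff_infty.1 hcd 2, contDiff_const,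
    ?_, fun θ => ?_, fun θ => ?_, fun θ => by simp⟩,
    (ZeroFlux.comp_sub_const_iff h.periodic θ₀).2 h.zeroFlux⟩
  · simp only [hp, hper θ]
  · rw [hpe]
    exact (contDiff_const.mul (contDiff_infty.1 hcd 1)).sub contDiff_const
  · simp [hp]
  · rw [funext fun t => (hd1 t).deriv, (hd2 θ).deriv, hp θ]
    simp only [abs_zero]
    linarith

theorem IsReducedSolution.eq_zero_or_eq_cnoidalWave {f v p : ℝ → ℝ} (h : IsReducedSolution f v p)
    (hflux : ZeroFlux f) :
    ((∀ θ, f θ = 0) ∧ (∃ c : ℝ, ∀ θ, v θ = c) ∧ (∀ θ, p θ = -|v θ| ^ 2 / 2)) ∨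
      ∃ k : ℕ, 3 ≤ k ∧ ∃ e₁ e₂ e₃, IsZeroFluxCnoidal k e₁ e₂ e₃ ∧ ∃ θ₀ : ℝ,
        (∀ θ, f θ = cnoidalWave e₁ e₂ e₃ (θ - θ₀)) ∧ (∀ θ, v θ = 0) ∧
        (∀ θ, p θ = 2 * f θ
          - 1 / (4 * Real.pi) * ∫ t in (0 : ℝ)..(2 * Real.pi), cnoidalWave e₁ e₂ e₃ t ^ 2) := by
  obtain ⟨c, w, hv, hp, hf, hf'⟩ := h.exists_ode
  have hpi := Real.pi_pos
  by_cases hne : ∃ s t, f s ≠ f t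
  · right
    have hw : w = 0 := by
      by_contra hw
      obtain ⟨s, t, hst⟩ := hne
      exact hst (is_const_of_deriv_eq_zero (fun t => (hf t).differentiableAt)
        (deriv_eq_zero_of_damped_periodic Real.two_pi_pos hw h.periodic_f hf hf') s t)
    subst hw
    have hode : ∀ t, HasDerivAt (deriv f) (-f t ^ 2 - 4 * f t - 2 * c) t := fun t =>
      (hf' t).congr_deriv (by ring)
    obtain ⟨e₁, e₂, e₃, θ₀, h32, h21, hs, heq⟩ :=
      exists_eq_cnoidalWave Real.two_pi_pos h.periodic_f hf hode hne
    have hg : ∀ θ, cnoidalWave e₁ e₂ e₃ θ = f (θ + θ₀) := fun θ => by simp [heq]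
    have hper : Function.Periodic (cnoidalWave e₁ e₂ e₃) (2 * Real.pi) := by
      rw [funext hg]
      exact h.periodic_f.add_const θ₀
    have hz : ZeroFlux (cnoidalWave e₁ e₂ e₃) := by
      rw [← ZeroFlux.comp_sub_const_iff hper θ₀, ← funext heq]
      exact hflux
    obtain ⟨k, hk, hdata⟩ := exists_isZeroFluxCnoidal h32 h21 hs hper hz
    refine ⟨k, hk, e₁, e₂, e₃, hdata, θ₀, heq, hv, fun θ => ?_⟩
    -- The pressure constant comes from the mean of the equation: 2c = -(1/2π) ∫ g² for the
    -- unrotated wave g.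
    have hc := eq_neg_integral_sq_of_periodic hper
      (g' := fun θ => deriv f (θ + θ₀)) (d := 2 * c)
      (fun t => by rw [funext hg]; exact (hf _).comp_add_const t θ₀)
      (fun t => by rw [hg]; exact (hode _).comp_add_const t θ₀) hz
    rw [hp]
    field_simp at hc ⊢
    linarith
  · left
    push Not at hne
    have h0 : ∀ θ, f θ = 0 := fun θ => by
      have hI : ∫ θ in (0 : ℝ)..(2 * Real.pi), f θ = 0 := hflux
      rw [funext fun t => hne t θ, intervalIntegral.integral_const] at hI
      simpa [hpi.ne'] using hI
    refine ⟨h0, ⟨w, hv⟩, fun θ => ?_⟩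
    have hr := h.radial θ
    have hfz : f = fun _ => 0 := funext h0
    rw [hfz] at hr
    simp at hr
    rw [sq_abs]
    linarith

theorem theorem2 :
    ∃ F : ℕ → ℝ → ℝ,
      (∀ k : ℕ, 3 ≤ k →
        ContDiff ℝ ∞ (F k) ∧ (∃ θ, F k θ ≠ 0) ∧
        HasMinimalPeriod (F k) (2 * Real.pi / k) ∧ IsCnoidal (F k)) ∧
      (∃ a A : ℝ, 0 < a ∧ 0 < A ∧ ∀ k : ℕ, 3 ≤ k →
        a * (k : ℝ) ^ 2 ≤ oscillationAmplitude (F k) ∧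
        oscillationAmplitude (F k) ≤ A * (k : ℝ) ^ 2) ∧
      (∀ f v p : ℝ → ℝ,
        (IsReducedSolution f v p ∧ ZeroFlux f) ↔
          ((∀ θ, f θ = 0) ∧ (∃ c : ℝ, ∀ θ, v θ = c) ∧ (∀ θ, p θ = -|v θ| ^ 2 / 2)) ∨
          (∃ k : ℕ, 3 ≤ k ∧ ∃ θ₀ : ℝ,
            (∀ θ, f θ = F k (θ - θ₀)) ∧ (∀ θ, v θ = 0) ∧
            (∀ θ, p θ = 2 * f θ
              - 1 / (4 * Real.pi) * ∫ t in (0 : ℝ)..(2 * Real.pi), F k t ^ 2))) := by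
  obtain ⟨a, A, ha, hA, h⟩ := exists_isZeroFluxCnoidal_amplitude_bounds
  choose! e₁ e₂ e₃ hdata hlow hupp using h
  refine ⟨fun k => cnoidalWave (e₁ k) (e₂ k) (e₃ k), fun k hk => ?_, ⟨a, A, ha, hA, fun k hk => ?_⟩,
    fun f v p => ⟨fun h => ?_, fun h => ?_⟩⟩
  · have hd := hdata k hk
    refine ⟨contDiff_cnoidalWave hd.lt₃₂ hd.lt₂₁, ?_, hd.hasMinimalPeriod,
      e₁ k, e₂ k, e₃ k, hd.lt₃₂, hd.lt₂₁, hd.sum_eq, fun θ => rfl⟩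
    by_contra! hz
    obtain ⟨θ, hθ⟩ := exists_cnoidalWave_eq_min hd.lt₃₂ hd.lt₂₁
    have h0 := cnoidalWave_zero hd.lt₃₂ hd.lt₂₁
    rw [hz] at hθ h0
    exact hd.lt₂₁.ne (hθ.symm.trans h0)
  · have hd := hdata k hk
    rw [oscillationAmplitude_cnoidalWave hd.lt₃₂ hd.lt₂₁]
    exact ⟨hlow k hk, hupp k hk⟩
  · refine (h.1.eq_zero_or_eq_cnoidalWave h.2).imp_right ?_
    rintro ⟨k, hk, x₁, x₂, x₃, hx, hrest⟩
    -- Uniqueness identifies the roots found for f with those chosen once for each k.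
    obtain ⟨rfl, rfl, rfl⟩ := hx.unique (hdata k hk)
    exact ⟨k, hk, hrest⟩
  · rcases h with ⟨hf, hv, hp⟩ | ⟨k, hk, θ₀, hf, hv, hp⟩
    · exact isReducedSolution_of_eq_zero hf hv hp
    · exact (hdata k hk).isReducedSolution hf hv hp
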